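/- For $\nu\ge 0$ let $J_\nu$ be the Bessel function of the first kind of order $\nu$. For $k\in\mathbb{N}=\{1,2,\dots\}$ let $j_{\nu,k}$ be the $k$th positive zero of $J_\nu$ and let $j'_{\nu,k}$ be the $k$th positive zero of its derivative $J'_\nu$, except that for $\nu=0$ the zero of $J_0'$ at the origin is counted as the first one, so that $j'_{0,1}=0$ and $j'_{0,k+1}$ is the $k$th positive zero of $J_0'$. For $0\le z\le\lambda$, $\lambda>0$, set $$G_\lambda(z)=\frac1\pi\left(\sqrt{\lambda^2-z^2}-z\arccos\frac z\lambda\right),$$ and set $G_0(0)=0$. Let $s^{\mathrm D}=\frac14$, $s^{\mathrm N}=\frac34$, and for $\nu,\lambda\ge 0$ and $\aleph\in\{\mathrm D,\mathrm N\}$ let $$A_\nu^{\aleph}(\lambda)=\begin{cases}G_\lambda(\nu)+s^{\aleph},&\lambda\ge\nu,\\ s^{\aleph},&0\le\lambda<\nu.\end{cases}$$ Let $\lfloor x\rfloor$ denote the integer part of $x$. **Proposition.** Let $\nu\ge 0$ and $\lambda\ge 0$. Then the sets $\{k\in\mathbb{N}: j_{\nu,k}\le\lambda\}$ and $\{k\in\mathbb{N}: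 j'_{\nu,k}\le\lambda\}$ are finite, and $$\#\{k\in\mathbb{N}: j_{\nu,k}\le\lambda\}\le\lfloor A_\nu^{\mathrm D}(\lambda)\rfloor \qquad\text{and}\qquad \#\{k\in\mathbb{N}: j'_{\nu,k}\le\lambda\}\ge\lfloor A_\nu^{\mathrm N}(\lambda)\rfloor .$$ -/

import Mathlib

/-- The Bessel function of the first kind of real order `ν`, for a nonnegative real argument:
`J_ν(x) = (x/2)^ν ∑ₘ (-1)^m / (m! Γ(m + ν + 1)) (x/2)^(2m)`. -/
noncomputable def besselJ (ν x : ℝ) : ℝ :=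
  (x / 2) ^ ν *
    ∑' m : ℕ, (-1 : ℝ) ^ m / ((Nat.factorial m : ℝ) * Real.Gamma (m + ν + 1)) *
      (x / 2) ^ (2 * m)

/-- The `k`th smallest element (`k = 1, 2, …`) of a set `S` of reals, i.e. the element of `S`
with exactly `k - 1` elements of `S` below it. There is at most one such element;
the value is `0` if there is none. -/
noncomputable def kthElement (S : Set ℝ) (k : ℕ) : ℝ :=
  sInf {x : ℝ | x ∈ S ∧ (S ∩ Set.Iio x).encard + 1 = (k : ℕ∞)}

/-- `j_{ν,k}`, `k ≥ 1`: the `k`th positive zero of `J_ν`. -/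
noncomputable def besselJZero (ν : ℝ) (k : ℕ) : ℝ :=
  kthElement {x : ℝ | 0 < x ∧ besselJ ν x = 0} k

/-- `j'_{ν,k}`, `k ≥ 1`: the `k`th positive zero of `J_ν'`, except that for `ν = 0` the zero of
`J_0'` at the origin is counted as the first one, so `j'_{0,1} = 0` and `j'_{0,k+1}` is the
`k`th positive zero of `J_0'`. -/
noncomputable def besselJDerivZero (ν : ℝ) (k : ℕ) : ℝ :=
  kthElement
    {x : ℝ | (0 < x ∧ deriv (besselJ ν) x = 0) ∨ (ν = 0 ∧ x = 0)} k

/-- `G_lam(z) = (√(lam² - z²) - z arccos (z / lam)) / π`, for `0 ≤ z ≤ lam`. -/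
noncomputable def funG (lam z : ℝ) : ℝ :=
  1 / Real.pi * (Real.sqrt (lam ^ 2 - z ^ 2) - z * Real.arccos (z / lam))

/-- `G_lam(ν) + s` if `lam ≥ ν`, and `s` if `lam < ν`. -/
noncomputable def funA (s ν lam : ℝ) : ℝ :=
  if ν ≤ lam then funG lam ν + s else s

/-- The Dirichlet function `A_ν^D`, with shift `1/4`. -/
noncomputable def funAD (ν lam : ℝ) : ℝ := funA (1 / 4) ν lam

/-- The Neumann function `A_ν^N`, with shift `3/4`. -/
noncomputable def funAN (ν lam : ℝ) : ℝ := funA (3 / 4) ν lam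

/-! In terms of D = x d/dx, Bessel's equation reads D²J = -(x² - ν²)J, and J_ν has the phase s(x) =
√(x² - ν²) - ν arccos(ν/x) = πG_x(ν) for x > ν. Both bounds come from comparing the zeros with this
phase by Sturm's theorem, and from fixing the constant of integration at infinity instead of at the
turning point x = ν.

The function (x² - ν²)^(-1/4) sin(s - c) satisfies D²f = -pf with p < x² - ν², so J_ν has a zero on
every stretch where s grows by π (`exists_besselJ_zero`). On the other hand, y = xJ_ν'/√(x² - ν²)
satisfies such an equation with a coefficient below p, so s grows by more than π between zeros of
J_ν' (`besselPhase_gap`). Hence, if s(b) = s(x) + mπ, then from x to b the number of zeros of J_ν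
grows by at least m and that of J_ν' by at most m.

As m tends to infinity, b - νπ/2 - s(b) tends to 0, so it remains to know the counts far out. With α
= νπ/2 + π/4, there are exactly k zeros of J_ν up to any point well inside the window |x - α - kπ| <
π/2 (`besselCountAsymptotics`), and more than k zeros of J_ν' up to α + kπ + ε
(`eventually_lt_besselDerivCount`). Going back from b to x gives the shifts 1/4 and 3/4
(`pi_mul_besselCount_le`, `le_besselDerivCount`).

The asymptotics √x J_ν ≈ A cos(x - α), obtained from Poisson's integral by a contour shift, show
only that J_ν has no zeros in the middle of the windows; they do not number the windows. The
numbering is explicit for ν = 1/2, where the zeros are those of sin, and passes to all ν because the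
count decreases in ν and drops by at most 1 from ν to ν + 1. -/

open Filter Topology Set MeasureTheory

/-! ### The power series of J_ν -/

/-- The coefficients of the entire function `y ↦ ∑ₘ (-1)^m y^m / (m! Γ(m + ν + 1))`. -/
noncomputable def besselCoeff (ν : ℝ) (m : ℕ) : ℝ :=
  (-1 : ℝ) ^ m / ((Nat.factorial m : ℝ) * Real.Gamma (m + ν + 1))

/-- The entire function `φ_ν` with `J_ν(x) = (x/2)^ν φ_ν(x²/4)`. -/
noncomputable def besselSeries (ν y : ℝ) : ℝ := ∑' m : ℕ, besselCoeff ν m * y ^ m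

theorem besselJ_eq (ν x : ℝ) : besselJ ν x = (x / 2) ^ ν * besselSeries ν ((x / 2) ^ 2) := by
  simp only [besselJ, besselSeries, besselCoeff, pow_mul]

theorem gamma_index_pos {ν : ℝ} (hν : 0 ≤ ν) (m : ℕ) : 0 < Real.Gamma (m + ν + 1) :=
  Real.Gamma_pos_of_pos (by positivity)

theorem besselCoeff_ne_zero {ν : ℝ} (hν : 0 ≤ ν) (m : ℕ) : besselCoeff ν m ≠ 0 := by
  have := (gamma_index_pos hν m).ne'
  have := Nat.factorial_ne_zero m
  unfold besselCoeff
  positivity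

theorem besselCoeff_succ {ν : ℝ} (hν : 0 ≤ ν) (m : ℕ) :
    besselCoeff ν (m + 1) = -besselCoeff ν m / ((m + 1) * (m + ν + 1)) := by
  have h := (gamma_index_pos hν m).ne'
  have h1 : (m : ℝ) + ν + 1 ≠ 0 := by positivity
  have h2 : Real.Gamma (((m + 1 : ℕ) : ℝ) + ν + 1) = (m + ν + 1) * Real.Gamma (m + ν + 1) := by
    rw [← Real.Gamma_add_one h1]; push_cast; ring_nf
  have := Nat.factorial_ne_zero m
  unfold besselCoeff
  rw [h2, Nat.factorial_succ]
  push_cast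
  field_simp
  ring

theorem besselCoeff_index_succ {ν : ℝ} (hν : 0 ≤ ν) (m : ℕ) :
    besselCoeff ν m = (m + ν + 1) * besselCoeff (ν + 1) m := by
  have h := (gamma_index_pos hν m).ne'
  have h1 : (m : ℝ) + ν + 1 ≠ 0 := by positivity
  have h2 : Real.Gamma ((m : ℝ) + (ν + 1) + 1) = (m + ν + 1) * Real.Gamma (m + ν + 1) := by
    rw [← Real.Gamma_add_one h1]; ring_nf
  have := Nat.factorial_ne_zero m
  unfold besselCoeff
  rw [h2]
  field_simp

theorem succ_mul_besselCoeff_succ {ν : ℝ} (hν : 0 ≤ ν) (m : ℕ) :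
    (m + 1) * besselCoeff ν (m + 1) = -besselCoeff (ν + 1) m := by
  rw [besselCoeff_succ hν, besselCoeff_index_succ hν]
  have h1 : (m : ℝ) + ν + 1 ≠ 0 := by positivity
  field_simp

theorem abs_besselCoeff_le {ν : ℝ} (hν : 0 ≤ ν) (m : ℕ) :
    |besselCoeff ν m| ≤ (Real.Gamma (ν + 1))⁻¹ / (Nat.factorial m : ℝ) := by
  have h0 : 0 < Real.Gamma (ν + 1) := Real.Gamma_pos_of_pos (by positivity)
  induction m with
  | zero => simp [besselCoeff, abs_of_pos h0]
  | succ m ih =>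
    rw [besselCoeff_succ hν, abs_div, abs_neg, Nat.factorial_succ,
      abs_of_pos (by positivity : (0 : ℝ) < (m + 1) * (m + ν + 1))]
    have h1 : (1 : ℝ) ≤ m + ν + 1 := by linarith [(Nat.cast_nonneg m : (0 : ℝ) ≤ m)]
    calc |besselCoeff ν m| / ((m + 1) * (m + ν + 1))
        ≤ ((Real.Gamma (ν + 1))⁻¹ / (Nat.factorial m : ℝ)) / ((m + 1) * 1) := by gcongr
      _ = _ := by push_cast; field_simp

theorem summable_besselCoeff_mul_pow {ν : ℝ} (hν : 0 ≤ ν) (y : ℝ) :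
    Summable fun m => besselCoeff ν m * y ^ m := by
  refine Summable.of_norm_bounded
    ((Real.summable_pow_div_factorial |y|).mul_left (Real.Gamma (ν + 1))⁻¹) fun m => ?_
  rw [norm_mul, norm_pow, Real.norm_eq_abs, Real.norm_eq_abs]
  calc |besselCoeff ν m| * |y| ^ m
      ≤ (Real.Gamma (ν + 1))⁻¹ / (Nat.factorial m : ℝ) * |y| ^ m := by
        gcongr; exact abs_besselCoeff_le hν m
    _ = _ := by ring

theorem hasSum_besselSeries {ν : ℝ} (hν : 0 ≤ ν) (y : ℝ) :
    HasSum (fun m => besselCoeff ν m * y ^ m) (besselSeries ν y) :=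
  (summable_besselCoeff_mul_pow hν y).hasSum

theorem hasDerivAt_besselSeries {ν : ℝ} (hν : 0 ≤ ν) (y : ℝ) :
    HasDerivAt (besselSeries ν) (-besselSeries (ν + 1) y) y := by
  set R := |y| + 1
  have hR : 0 ≤ R := by positivity
  have hg0 : 0 < Real.Gamma (ν + 1) := Real.Gamma_pos_of_pos (by positivity)
  have key : HasDerivAt (fun z => ∑' m : ℕ, besselCoeff ν m * z ^ m)
      (∑' m : ℕ, besselCoeff ν m * (m * y ^ (m - 1))) y := by
    refine hasDerivAt_tsum_of_isPreconnected (t := Metric.ball 0 R) (y₀ := y)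
      (u := fun m => (Real.Gamma (ν + 1))⁻¹ / (Nat.factorial m : ℝ) * (m * R ^ (m - 1)))
      ?_ Metric.isOpen_ball (convex_ball _ _).isPreconnected
      (fun m z _ => (hasDerivAt_pow m z).const_mul _) (fun m z hz => ?_) (by simp [R])
      (summable_besselCoeff_mul_pow hν y) (by simp [R])
    · rw [← summable_nat_add_iff 1]
      refine ((Real.summable_pow_div_factorial R).mul_left (Real.Gamma (ν + 1))⁻¹).congr
        fun m => ?_
      rw [Nat.factorial_succ]
      have := Nat.factorial_ne_zero m
      simp only [Nat.add_sub_cancel]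
      push_cast
      field_simp
    · rw [norm_mul, norm_mul, norm_pow, Real.norm_eq_abs, Real.norm_natCast]
      have hz' : ‖z‖ ≤ R := (mem_ball_zero_iff.1 hz).le
      gcongr
      exact abs_besselCoeff_le hν m
  have key' : HasDerivAt (besselSeries ν) _ y := key
  convert key' using 1
  have hs : Summable fun m : ℕ => besselCoeff ν m * (m * y ^ (m - 1)) := by
    rw [← summable_nat_add_iff 1]
    refine (summable_besselCoeff_mul_pow (ν := ν + 1) (by positivity) y).neg.congr fun m => ?_
    have := succ_mul_besselCoeff_succ hν m
    simp only [Nat.add_sub_cancel]; push_cast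
    linear_combination (- y ^ m) * this
  rw [hs.tsum_eq_zero_add]
  simp only [besselSeries, ← tsum_neg, Nat.cast_zero, zero_mul, mul_zero, zero_add]
  refine tsum_congr fun m => ?_
  have := succ_mul_besselCoeff_succ hν m
  simp only [Nat.add_sub_cancel]; push_cast
  linear_combination (- y ^ m) * this

theorem besselSeries_recurrence {ν : ℝ} (hν : 0 ≤ ν) (y : ℝ) :
    besselSeries ν y = (ν + 1) * besselSeries (ν + 1) y - y * besselSeries (ν + 2) y := by
  have h1 := (hasSum_besselSeries (ν := ν + 1) (by positivity) y).mul_left (ν + 1)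
  have h2 := (hasSum_besselSeries (ν := ν + 2) (by positivity) y).mul_left y
  have h3 : HasSum (fun m : ℕ => (m : ℝ) * besselCoeff (ν + 1) m * y ^ m)
      (-(y * besselSeries (ν + 2) y)) := by
    rw [← hasSum_nat_add_iff' 1]
    simp only [Finset.range_one, Finset.sum_singleton, Nat.cast_zero, zero_mul, sub_zero]
    refine h2.neg.congr_fun fun m => ?_
    have := succ_mul_besselCoeff_succ (ν := ν + 1) (by positivity) m
    rw [show ν + 1 + 1 = ν + 2 by ring] at this
    push_cast
    linear_combination (y ^ (m + 1)) * this
  refine (hasSum_besselSeries hν y).unique ?_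
  rw [sub_eq_add_neg]
  refine (h1.add h3).congr_fun fun m => ?_
  rw [besselCoeff_index_succ hν]; ring

theorem besselSeries_zero {ν : ℝ} (hν : 0 ≤ ν) : 0 < besselSeries ν 0 := by
  have h : besselSeries ν 0 = besselCoeff ν 0 := by
    refine (hasSum_besselSeries hν 0).unique ?_
    convert hasSum_ite_eq 0 (besselCoeff ν 0) using 2 with m
    rcases m with _ | m <;> simp
  have h0 : 0 < Real.Gamma (ν + 1) := Real.Gamma_pos_of_pos (by positivity)
  rw [h]
  simpa [besselCoeff] using h0

theorem continuous_besselSeries {ν : ℝ} (hν : 0 ≤ ν) : Continuous (besselSeries ν) :=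
  continuous_iff_continuousAt.2 fun y => (hasDerivAt_besselSeries hν y).continuousAt

/-- The ratio of consecutive coefficients tends to 0, so the radius of convergence is infinite.
Analyticity is what makes the zeros discrete. -/
theorem analyticOnNhd_besselSeries {ν : ℝ} (hν : 0 ≤ ν) :
    AnalyticOnNhd ℝ (besselSeries ν) univ := by
  have hr : (FormalMultilinearSeries.ofScalars ℝ (besselCoeff ν)).radius = ⊤ := by
    refine FormalMultilinearSeries.ofScalars_radius_eq_top_of_tendsto _ _
      (Eventually.of_forall (besselCoeff_ne_zero hν)) ?_
    refine squeeze_zero (fun _ => by positivity) (fun m => ?_)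
      tendsto_one_div_add_atTop_nhds_zero_nat
    have hc := norm_pos_iff.2 (besselCoeff_ne_zero hν m)
    rw [Nat.succ_eq_add_one, besselCoeff_succ hν, norm_div, norm_neg, Real.norm_of_nonneg
      (by positivity : (0 : ℝ) ≤ (m + 1) * (m + ν + 1)), div_div, div_le_div_iff₀ (by positivity)
      (by positivity), one_mul]
    nlinarith [mul_nonneg hc.le (by positivity : (0 : ℝ) ≤ (m + 1) * (m + ν))]
  have hp := (FormalMultilinearSeries.ofScalars ℝ (besselCoeff ν)).hasFPowerSeriesOnBall
    (by simp [hr])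
  rw [hr] at hp
  have he : (FormalMultilinearSeries.ofScalars ℝ (besselCoeff ν)).sum = besselSeries ν := by
    funext y
    simp [FormalMultilinearSeries.sum, besselSeries, smul_eq_mul, mul_comm]
  rw [he] at hp
  intro y _
  exact hp.analyticOnNhd y (by simp)

theorem finite_zeros_of_analyticOnNhd {f : ℝ → ℝ} (hf : AnalyticOnNhd ℝ f univ)
    {x₀ : ℝ} (h0 : f x₀ ≠ 0) (a b : ℝ) : ({x | f x = 0} ∩ Icc a b).Finite := by
  by_contra hinf
  obtain ⟨x, -, hx⟩ := Set.Infinite.exists_accPt_of_subset_isCompact hinf isCompact_Icc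
    inter_subset_right
  refine h0 (hf.eqOn_zero_of_preconnected_of_frequently_eq_zero isPreconnected_univ
    (mem_univ x) ?_ (mem_univ x₀))
  exact (accPt_iff_frequently_nhdsNE.1 hx).mono fun y hy => hy.1

/-! ### Bessel's equation as a first-order system in x d/dx -/

/-- `x J_ν'(x)`, written by means of the recurrence `x J_ν' = ν J_ν - x J_{ν+1}`. -/
noncomputable def besselK (ν x : ℝ) : ℝ := ν * besselJ ν x - x * besselJ (ν + 1) x

theorem besselJ_succ_eq {ν x : ℝ} (hx : 0 < x) :
    besselJ (ν + 1) x = (x / 2) ^ ν * (x / 2 * besselSeries (ν + 1) ((x / 2) ^ 2)) := by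
  rw [besselJ_eq, Real.rpow_add_one (by positivity)]; ring

theorem hasDerivAt_besselJ {ν x : ℝ} (hν : 0 ≤ ν) (hx : 0 < x) :
    HasDerivAt (besselJ ν) (besselK ν x / x) x := by
  have h1 : HasDerivAt (fun x : ℝ => (x / 2) ^ ν) (1 / 2 * ν * (x / 2) ^ (ν - 1)) x :=
    ((hasDerivAt_id x).div_const 2).rpow_const (Or.inl (by simp; positivity))
  have h2 : HasDerivAt (fun x : ℝ => besselSeries ν ((x / 2) ^ 2))
      (-besselSeries (ν + 1) ((x / 2) ^ 2) * (2 * (x / 2) * (1 / 2))) x := by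
    refine (hasDerivAt_besselSeries hν _).comp x ?_
    simpa using ((hasDerivAt_id x).div_const 2).fun_pow 2
  have h3 := h1.mul h2
  have he : besselJ ν = fun x => (x / 2) ^ ν * besselSeries ν ((x / 2) ^ 2) := by
    funext x; exact besselJ_eq ν x
  rw [he]
  refine h3.congr_deriv ?_
  have hp : (x / 2) ^ (ν - 1) = (x / 2) ^ ν / (x / 2) := Real.rpow_sub_one (by positivity) _
  rw [besselK, besselJ_succ_eq hx, besselJ_eq, hp]
  field_simp
  ring

theorem besselJ_recurrence {ν x : ℝ} (hν : 0 ≤ ν) (hx : 0 < x) :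
    x * besselJ ν x = 2 * (ν + 1) * besselJ (ν + 1) x - x * besselJ (ν + 2) x := by
  have h2 : besselJ (ν + 2) x = (x / 2) ^ ν * ((x / 2) ^ 2 * besselSeries (ν + 2) ((x / 2) ^ 2)) := by
    rw [besselJ_eq, Real.rpow_add (by positivity), Real.rpow_two]; ring
  rw [h2, besselJ_succ_eq hx, besselJ_eq, besselSeries_recurrence hν]
  ring

/-- Together with `hasDerivAt_besselJ` this is Bessel's equation; it follows from the three-term
recurrence. -/
theorem hasDerivAt_besselK {ν x : ℝ} (hν : 0 ≤ ν) (hx : 0 < x) :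
    HasDerivAt (besselK ν) (-(x ^ 2 - ν ^ 2) * besselJ ν x / x) x := by
  have h := ((hasDerivAt_besselJ hν hx).const_mul ν).sub
    ((hasDerivAt_id x).mul (hasDerivAt_besselJ (ν := ν + 1) (by positivity) hx))
  refine h.congr_deriv ?_
  have hr := besselJ_recurrence hν hx
  simp only [besselK, id]
  rw [show ν + 1 + 1 = ν + 2 by ring]
  field_simp
  linear_combination x * hr

theorem deriv_besselJ {ν x : ℝ} (hν : 0 ≤ ν) (hx : 0 < x) :
    deriv (besselJ ν) x = besselK ν x / x := (hasDerivAt_besselJ hν hx).deriv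

theorem continuousOn_besselJ {ν : ℝ} (hν : 0 ≤ ν) : ContinuousOn (besselJ ν) (Ioi 0) :=
  fun _ hx => (hasDerivAt_besselJ hν hx).continuousAt.continuousWithinAt

theorem continuousOn_besselK {ν : ℝ} (hν : 0 ≤ ν) : ContinuousOn (besselK ν) (Ioi 0) :=
  fun _ hx => (hasDerivAt_besselK hν hx).continuousAt.continuousWithinAt

theorem continuous_besselJ {ν : ℝ} (hν : 0 ≤ ν) : Continuous (besselJ ν) := by
  have he : besselJ ν = fun x => (x / 2) ^ ν * besselSeries ν ((x / 2) ^ 2) := by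
    funext x; exact besselJ_eq ν x
  rw [he]
  exact ((continuous_id.div_const 2).rpow_const fun _ => Or.inr hν).mul
    ((continuous_besselSeries hν).comp (by fun_prop))

theorem besselJ_at_zero {ν : ℝ} (hν : 0 < ν) : besselJ ν 0 = 0 := by
  rw [besselJ_eq, zero_div, Real.zero_rpow hν.ne', zero_mul]

theorem tendsto_besselK_zero {ν : ℝ} (hν : 0 ≤ ν) : Tendsto (besselK ν) (𝓝[>] 0) (𝓝 0) := by
  have hc : Continuous (besselK ν) :=
    ((continuous_besselJ hν).const_mul ν).sub
      (continuous_id.mul (continuous_besselJ (ν := ν + 1) (by positivity)))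
  have h := hc.tendsto 0
  have h0 : besselK ν 0 = 0 := by
    rcases hν.eq_or_lt with rfl | hν
    · simp [besselK]
    · simp [besselK, besselJ_at_zero hν]
  rw [h0] at h
  exact h.mono_left nhdsWithin_le_nhds

theorem besselJ_pos_near_zero {ν : ℝ} (hν : 0 ≤ ν) :
    ∀ᶠ x in 𝓝[>] (0 : ℝ), 0 < besselJ ν x := by
  have hc : Continuous fun x : ℝ => besselSeries ν ((x / 2) ^ 2) :=
    (continuous_besselSeries hν).comp (by fun_prop)
  have h : ∀ᶠ x in 𝓝 (0 : ℝ), 0 < besselSeries ν ((x / 2) ^ 2) := by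
    refine hc.continuousAt.eventually_const_lt ?_
    simpa using besselSeries_zero hν
  filter_upwards [h.filter_mono nhdsWithin_le_nhds, self_mem_nhdsWithin] with x hx hx0
  rw [besselJ_eq]
  have : 0 < x := hx0
  positivity

/-! ### Zero sets and counting functions -/

/-- The positive zeros of `J_ν`. -/
def besselZeros (ν : ℝ) : Set ℝ := {x | 0 < x ∧ besselJ ν x = 0}

/-- The zeros of `J_ν'`, the origin being included if `ν = 0`. -/
def besselDerivZeros (ν : ℝ) : Set ℝ :=
  {x | (0 < x ∧ deriv (besselJ ν) x = 0) ∨ (ν = 0 ∧ x = 0)}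

theorem mem_besselDerivZeros_of_pos {ν x : ℝ} (hν : 0 ≤ ν) (hx : 0 < x) :
    x ∈ besselDerivZeros ν ↔ besselK ν x = 0 := by
  simp [besselDerivZeros, hx, hx.ne', deriv_besselJ hν hx]

theorem nonneg_of_mem_besselDerivZeros {ν x : ℝ} (h : x ∈ besselDerivZeros ν) : 0 ≤ x := by
  rcases h with h | h
  · exact h.1.le
  · exact h.2.ge

/-- Dividing by (x/2)^ν leaves a function that is analytic and nonzero at 0, so the zeros cannot
accumulate at the origin either. -/
theorem finite_besselZeros {ν : ℝ} (hν : 0 ≤ ν) (X : ℝ) : (besselZeros ν ∩ Iic X).Finite := by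
  have ha : AnalyticOnNhd ℝ (fun x : ℝ => besselSeries ν ((x / 2) ^ 2)) univ := fun x _ =>
    (analyticOnNhd_besselSeries hν _ (mem_univ _)).comp_of_eq (by fun_prop) rfl
  refine (finite_zeros_of_analyticOnNhd (x₀ := 0) ha (by
    simpa using (besselSeries_zero hν).ne') 0 X).subset ?_
  rintro x ⟨⟨hx, h⟩, hX⟩
  refine ⟨?_, hx.le, hX⟩
  rw [besselJ_eq] at h
  exact (mul_eq_zero.1 h).resolve_left (by positivity)

theorem finite_besselDerivZeros {ν : ℝ} (hν : 0 ≤ ν) (X : ℝ) :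
    (besselDerivZeros ν ∩ Iic X).Finite := by
  have ha (μ : ℝ) (hμ : 0 ≤ μ) :
      AnalyticOnNhd ℝ (fun x : ℝ => besselSeries μ ((x / 2) ^ 2)) univ := fun x _ =>
    (analyticOnNhd_besselSeries hμ _ (mem_univ _)).comp_of_eq (by fun_prop) rfl
  have hν1 : 0 ≤ ν + 1 := by positivity
  have key : ∀ x, 0 < x → besselK ν x = (x / 2) ^ ν *
      (ν * besselSeries ν ((x / 2) ^ 2) - x * (x / 2) * besselSeries (ν + 1) ((x / 2) ^ 2)) := by
    intro x hx
    rw [besselK, besselJ_succ_eq hx, besselJ_eq]; ring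
  rcases hν.eq_or_lt with rfl | hν0
  -- For ν = 0 the analytic factor vanishes at 0 and gives no base point there; its factor x²/2 is
  -- removed and the series of index 1 remains.
  · refine ((finite_zeros_of_analyticOnNhd (x₀ := 0) (ha (0 + 1) hν1) (by
      simpa using (besselSeries_zero (ν := 1) (by norm_num)).ne') 0 X).insert 0).subset ?_
    rintro x ⟨h, hX⟩
    rcases (nonneg_of_mem_besselDerivZeros h).eq_or_lt with rfl | hx
    · simp
    · right
      rw [mem_besselDerivZeros_of_pos le_rfl hx, key x hx] at h
      refine ⟨?_, hx.le, hX⟩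
      simpa [hx.ne'] using h
  · refine (finite_zeros_of_analyticOnNhd (x₀ := 0) (f := fun x => ν * besselSeries ν ((x / 2) ^ 2)
      - x * (x / 2) * besselSeries (ν + 1) ((x / 2) ^ 2)) ?_ ?_ 0 X).subset ?_
    · have h1 : AnalyticOnNhd ℝ (fun x : ℝ => x * (x / 2)) univ := fun x _ => by fun_prop
      exact (analyticOnNhd_const.mul (ha ν hν)).sub (h1.mul (ha _ hν1))
    · simpa using ⟨hν0.ne', (besselSeries_zero hν).ne'⟩
    · rintro x ⟨h, hX⟩
      have hx : 0 < x := by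
        rcases h with h | h
        · exact h.1
        · exact absurd h.1 hν0.ne'
      rw [mem_besselDerivZeros_of_pos hν hx, key x hx] at h
      exact ⟨(mul_eq_zero.1 h).resolve_left (by positivity), hx.le, hX⟩

/-- The number of zeros of `J_ν` in `(0, x]`. -/
noncomputable def besselCount (ν x : ℝ) : ℕ := (besselZeros ν ∩ Iic x).ncard

/-- The number of zeros of `J_ν'` up to `x`. -/
noncomputable def besselDerivCount (ν x : ℝ) : ℕ := (besselDerivZeros ν ∩ Iic x).ncard

theorem besselCount_mono {ν : ℝ} (hν : 0 ≤ ν) : Monotone (besselCount ν) := fun _ y h =>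
  ncard_le_ncard (inter_subset_inter_right _ (Iic_subset_Iic.2 h)) (finite_besselZeros hν y)

theorem besselCount_congr {ν x y : ℝ} (hxy : x ≤ y) (h : ∀ z ∈ Ioc x y, besselJ ν z ≠ 0) :
    besselCount ν x = besselCount ν y := by
  unfold besselCount
  congr 1
  ext z
  refine ⟨fun hz => ⟨hz.1, hz.2.trans hxy⟩, fun hz => ⟨hz.1, ?_⟩⟩
  by_contra hzx
  exact h z ⟨not_le.1 hzx, hz.2⟩ hz.1.2

/-! ### Wronskians and Sturm comparison -/

theorem HasDerivAt.nonpos_of_pos_left {f : ℝ → ℝ} {f' a b : ℝ} (hab : a < b)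
    (h : HasDerivAt f f' b) (h0 : f b = 0) (hp : ∀ x ∈ Ioo a b, 0 < f x) : f' ≤ 0 := by
  have hs : Tendsto (slope f b) (𝓝[<] b) (𝓝 f') :=
    (hasDerivAt_iff_tendsto_slope.1 h).mono_left (nhdsWithin_mono _ fun x hx => ne_of_lt hx)
  refine le_of_tendsto hs ?_
  filter_upwards [Ioo_mem_nhdsLT hab] with x hx
  rw [slope_def_field, h0, sub_zero]
  exact div_nonpos_of_nonneg_of_nonpos (hp x hx).le (by linarith [hx.2])

theorem HasDerivAt.nonneg_of_pos_right {f : ℝ → ℝ} {f' a b : ℝ} (hab : a < b)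
    (h : HasDerivAt f f' a) (h0 : f a = 0) (hp : ∀ x ∈ Ioo a b, 0 < f x) : 0 ≤ f' := by
  have hs : Tendsto (slope f a) (𝓝[>] a) (𝓝 f') :=
    (hasDerivAt_iff_tendsto_slope.1 h).mono_left (nhdsWithin_mono _ fun x hx => ne_of_gt hx)
  refine ge_of_tendsto hs ?_
  filter_upwards [Ioo_mem_nhdsGT hab] with x hx
  rw [slope_def_field, h0, sub_zero]
  exact div_nonneg (hp x hx).le (by linarith [hx.1])

theorem nonneg_of_pos_left {f : ℝ → ℝ} {a b : ℝ} (hab : a < b) (h : ContinuousAt f b)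
    (hp : ∀ x ∈ Ioo a b, 0 < f x) : 0 ≤ f b :=
  ge_of_tendsto (h.tendsto.mono_left nhdsWithin_le_nhds : Tendsto f (𝓝[<] b) _)
    (by filter_upwards [Ioo_mem_nhdsLT hab] with x hx using (hp x hx).le)

theorem nonneg_of_pos_right {f : ℝ → ℝ} {a b : ℝ} (hab : a < b) (h : ContinuousAt f a)
    (hp : ∀ x ∈ Ioo a b, 0 < f x) : 0 ≤ f a :=
  ge_of_tendsto (h.tendsto.mono_left nhdsWithin_le_nhds : Tendsto f (𝓝[>] a) _)
    (by filter_upwards [Ioo_mem_nhdsGT hab] with x hx using (hp x hx).le)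

theorem pos_or_neg_of_ne_zero {f : ℝ → ℝ} {a b : ℝ} (hf : ContinuousOn f (Ioo a b))
    (h : ∀ x ∈ Ioo a b, f x ≠ 0) : (∀ x ∈ Ioo a b, 0 < f x) ∨ ∀ x ∈ Ioo a b, 0 < -f x := by
  by_contra! hc
  obtain ⟨⟨x, hx, hfx⟩, y, hy, hfy⟩ := hc
  obtain ⟨z, hz, hz0⟩ := isPreconnected_Ioo.intermediate_value hx hy hf
    (⟨hfx, by linarith⟩ : (0 : ℝ) ∈ Icc (f x) (f y))
  exact h z hz hz0

/-- The Wronskian W = Fg - fG satisfies x W' = (q - p)fg > 0. -/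
theorem wronskian_lt {f F g G p q : ℝ → ℝ} {a b : ℝ} (ha : 0 < a) (hab : a < b)
    (hf : ∀ x ∈ Icc a b, HasDerivAt f (F x / x) x)
    (hF : ∀ x ∈ Icc a b, HasDerivAt F (-p x * f x / x) x)
    (hg : ∀ x ∈ Icc a b, HasDerivAt g (G x / x) x)
    (hG : ∀ x ∈ Icc a b, HasDerivAt G (-q x * g x / x) x)
    (hpq : ∀ x ∈ Ioo a b, p x < q x)
    (hfp : ∀ x ∈ Ioo a b, 0 < f x) (hgp : ∀ x ∈ Ioo a b, 0 < g x) :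
    F a * g a - f a * G a < F b * g b - f b * G b := by
  have hd : ∀ x ∈ Icc a b, HasDerivAt (fun x => F x * g x - f x * G x)
      ((q x - p x) * (f x * g x) / x) x := by
    intro x hx
    refine (((hF x hx).mul (hg x hx)).sub ((hf x hx).mul (hG x hx))).congr_deriv ?_
    have : x ≠ 0 := (ha.trans_le hx.1).ne'
    field_simp
    ring
  have hm : StrictMonoOn (fun x => F x * g x - f x * G x) (Icc a b) := by
    refine strictMonoOn_of_deriv_pos (convex_Icc a b)
      (fun x hx => (hd x hx).continuousAt.continuousWithinAt) fun x hx => ?_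
    rw [interior_Icc] at hx
    rw [(hd x (Ioo_subset_Icc_self hx)).deriv]
    exact div_pos (mul_pos (sub_pos.2 (hpq x hx)) (mul_pos (hfp x hx) (hgp x hx)))
      (ha.trans hx.1)
  exact hm (left_mem_Icc.2 hab.le) (right_mem_Icc.2 hab.le) hab

theorem wronskian_pos {f F g G p q : ℝ → ℝ} {b : ℝ} (hb : 0 < b)
    (hf : ∀ x ∈ Ioc 0 b, HasDerivAt f (F x / x) x)
    (hF : ∀ x ∈ Ioc 0 b, HasDerivAt F (-p x * f x / x) x)
    (hg : ∀ x ∈ Ioc 0 b, HasDerivAt g (G x / x) x)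
    (hG : ∀ x ∈ Ioc 0 b, HasDerivAt G (-q x * g x / x) x)
    (hpq : ∀ x ∈ Ioo 0 b, p x < q x)
    (hfp : ∀ x ∈ Ioo 0 b, 0 < f x) (hgp : ∀ x ∈ Ioo 0 b, 0 < g x)
    (h0 : Tendsto (fun x => F x * g x - f x * G x) (𝓝[>] 0) (𝓝 0)) :
    0 < F b * g b - f b * G b := by
  have key : ∀ x y, 0 < x → x < y → y ≤ b →
      F x * g x - f x * G x < F y * g y - f y * G y := fun x y hx hxy hy =>
    wronskian_lt hx hxy (fun z hz => hf z ⟨hx.trans_le hz.1, hz.2.trans hy⟩)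
      (fun z hz => hF z ⟨hx.trans_le hz.1, hz.2.trans hy⟩)
      (fun z hz => hg z ⟨hx.trans_le hz.1, hz.2.trans hy⟩)
      (fun z hz => hG z ⟨hx.trans_le hz.1, hz.2.trans hy⟩)
      (fun z hz => hpq z ⟨hx.trans hz.1, hz.2.trans_le hy⟩)
      (fun z hz => hfp z ⟨hx.trans hz.1, hz.2.trans_le hy⟩)
      (fun z hz => hgp z ⟨hx.trans hz.1, hz.2.trans_le hy⟩)
  -- The limit at 0 yields only 0 ≤ W(b/2); the step from b/2 to b restores strictness.
  refine lt_of_le_of_lt (le_of_tendsto h0 ?_) (key (b / 2) b (by linarith) (by linarith) le_rfl)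
  filter_upwards [Ioo_mem_nhdsGT (show (0 : ℝ) < b / 2 by linarith)] with x hx
  exact (key x (b / 2) hx.1 hx.2 (by linarith)).le

/-- Sturm comparison: between consecutive zeros of a solution of `(x d/dx)² f = -p f` there is a
zero of every solution of `(x d/dx)² g = -q g` if `p < q`. -/
theorem sturm_exists_zero {f F g G p q : ℝ → ℝ} {a b : ℝ} (ha : 0 < a) (hab : a < b)
    (hf : ∀ x ∈ Icc a b, HasDerivAt f (F x / x) x)
    (hF : ∀ x ∈ Icc a b, HasDerivAt F (-p x * f x / x) x)
    (hg : ∀ x ∈ Icc a b, HasDerivAt g (G x / x) x)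
    (hG : ∀ x ∈ Icc a b, HasDerivAt G (-q x * g x / x) x)
    (hpq : ∀ x ∈ Ioo a b, p x < q x) (hfa : f a = 0) (hfb : f b = 0)
    (hf0 : ∀ x ∈ Ioo a b, f x ≠ 0) : ∃ c ∈ Ioo a b, g c = 0 := by
  by_contra! hg0
  have hb : 0 < b := ha.trans hab
  have hla := left_mem_Icc.2 hab.le
  have hrb := right_mem_Icc.2 hab.le
  -- For f, g > 0 the Wronskian is F(a)g(a) ≥ 0 at a and F(b)g(b) ≤ 0 at b, although it increases.
  -- The other sign patterns reduce to this one by negating f or g.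
  have main : ∀ {f F g G : ℝ → ℝ}, (∀ x ∈ Icc a b, HasDerivAt f (F x / x) x) →
      (∀ x ∈ Icc a b, HasDerivAt F (-p x * f x / x) x) →
      (∀ x ∈ Icc a b, HasDerivAt g (G x / x) x) →
      (∀ x ∈ Icc a b, HasDerivAt G (-q x * g x / x) x) → f a = 0 → f b = 0 →
      (∀ x ∈ Ioo a b, 0 < f x) → (∀ x ∈ Ioo a b, 0 < g x) → False := by
    intro f F g G hf hF hg hG hfa hfb hfp hgp
    have hW := wronskian_lt ha hab hf hF hg hG hpq hfp hgp
    have h1 := (hf a hla).nonneg_of_pos_right hab hfa hfp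
    have h2 := (hf b hrb).nonpos_of_pos_left hab hfb hfp
    have h3 := nonneg_of_pos_right hab (hg a hla).continuousAt hgp
    have h4 := nonneg_of_pos_left hab (hg b hrb).continuousAt hgp
    have h1' : 0 ≤ F a := by
      have := mul_nonneg h1 ha.le; rwa [div_mul_cancel₀ _ ha.ne'] at this
    have h2' : F b ≤ 0 := by
      have := mul_nonpos_of_nonpos_of_nonneg h2 hb.le; rwa [div_mul_cancel₀ _ hb.ne'] at this
    rw [hfa, hfb] at hW
    nlinarith [mul_nonneg h1' h3, mul_nonneg (neg_nonneg.2 h2') h4]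
  have neg1 : ∀ {f F : ℝ → ℝ}, (∀ x ∈ Icc a b, HasDerivAt f (F x / x) x) →
      ∀ x ∈ Icc a b, HasDerivAt (fun x => -f x) ((fun x => -F x) x / x) x :=
    fun h x hx => (h x hx).fun_neg.congr_deriv (by ring)
  have neg2 : ∀ {f F p : ℝ → ℝ}, (∀ x ∈ Icc a b, HasDerivAt F (-p x * f x / x) x) →
      ∀ x ∈ Icc a b, HasDerivAt (fun x => -F x) (-p x * (fun x => -f x) x / x) x :=
    fun h x hx => (h x hx).fun_neg.congr_deriv (by ring)
  rcases pos_or_neg_of_ne_zero (fun x hx =>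
    (hf x (Ioo_subset_Icc_self hx)).continuousAt.continuousWithinAt) hf0 with hfp | hfp <;>
  rcases pos_or_neg_of_ne_zero (fun x hx =>
    (hg x (Ioo_subset_Icc_self hx)).continuousAt.continuousWithinAt) hg0 with hgp | hgp
  · exact main hf hF hg hG hfa hfb hfp hgp
  · exact main hf hF (neg1 hg) (neg2 hG) hfa hfb hfp hgp
  · exact main (neg1 hf) (neg2 hF) hg hG (by simp [hfa]) (by simp [hfb]) hfp hgp
  · exact main (neg1 hf) (neg2 hF) (neg1 hg) (neg2 hG) (by simp [hfa]) (by simp [hfb]) hfp hgp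

/-! ### Interlacing of zeros -/

/-- Each b in T is sent to a point of S below b but not below the preceding element of T. These
choices are distinct. -/
theorem ncard_le_of_interlace {S T : Set ℝ} {X : ℝ} (hT : T.Finite) (hTX : ∀ b ∈ T, b ≤ X)
    (hS : (S ∩ Iic X).Finite)
    (h0 : ∀ b ∈ T, (∀ a ∈ T, b ≤ a) → ∃ c ∈ S, c < b)
    (h1 : ∀ a ∈ T, ∀ b ∈ T, a < b → (∀ t ∈ T, t ≤ a ∨ b ≤ t) → ∃ c ∈ S, a ≤ c ∧ c < b) :
    T.ncard ≤ (S ∩ Iic X).ncard := by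
  have key : ∀ b ∈ T, ∃ c ∈ S, c < b ∧ ∀ a ∈ T, a < b → a ≤ c := by
    intro b hb
    by_cases hmin : ∀ a ∈ T, b ≤ a
    · obtain ⟨c, hc, hcb⟩ := h0 b hb hmin
      exact ⟨c, hc, hcb, fun a ha hab => absurd (hmin a ha) (not_le.2 hab)⟩
    · push Not at hmin
      obtain ⟨a₀, ha₀, hab₀⟩ := hmin
      obtain ⟨a, ha, hmax⟩ := (hT.inter_of_left (Iio b)).exists_maximal ⟨a₀, ha₀, hab₀⟩
      have hle : ∀ t ∈ T, t < b → t ≤ a := fun t ht htb => by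
        by_contra hta
        exact hta (hmax ⟨ht, htb⟩ (le_of_not_ge hta))
      obtain ⟨c, hc, hac, hcb⟩ := h1 a ha.1 b hb ha.2 fun t ht =>
        (lt_or_ge t b).imp (hle t ht) id
      exact ⟨c, hc, hcb, fun t ht htb => (hle t ht htb).trans hac⟩
  choose! c hcS hcb hca using key
  refine ncard_le_ncard_of_injOn c (fun b hb => ⟨hcS b hb, (hcb b hb).le.trans (hTX b hb)⟩)
    (fun a ha b hb hab => ?_) hS
  rcases lt_trichotomy a b with h | h | h
  · linarith [hca b hb a ha h, hcb a ha]
  · exact h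
  · linarith [hca a ha b hb h, hcb b hb]

theorem besselJ_pos_of_ne_zero {ν b : ℝ} (hν : 0 ≤ ν)
    (h : ∀ x ∈ Ioo 0 b, besselJ ν x ≠ 0) : ∀ x ∈ Ioo 0 b, 0 < besselJ ν x := by
  intro x hx
  rcases pos_or_neg_of_ne_zero ((continuousOn_besselJ hν).mono fun x hx => hx.1) h with hp | hp
  · exact hp x hx
  · obtain ⟨y, hy, hyb⟩ := ((besselJ_pos_near_zero hν).and
      (Ioo_mem_nhdsGT (hx.1.trans hx.2))).exists
    linarith [hp y hyb]

/-- The larger index has the smaller coefficient x² - ν², so Sturm puts a zero of J_μ between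
consecutive zeros of J_ν. Below the first zero of J_ν the origin takes the place of the left
endpoint, as the Wronskian tends to 0 there. -/
theorem besselCount_anti_index {μ ν : ℝ} (hμ : 0 ≤ μ) (hμν : μ < ν) (X : ℝ) :
    besselCount ν X ≤ besselCount μ X := by
  have hν : 0 ≤ ν := hμ.trans hμν.le
  have hpq : ∀ x : ℝ, x ^ 2 - ν ^ 2 < x ^ 2 - μ ^ 2 := fun x => by nlinarith
  refine ncard_le_of_interlace (finite_besselZeros hν X) (fun b hb => hb.2)
    (finite_besselZeros hμ X) ?_ ?_
  · rintro b ⟨⟨hb, hJb⟩, hbX⟩ hmin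
    by_contra! hc
    have hνp := besselJ_pos_of_ne_zero (b := b) hν fun x hx h0 =>
      not_lt.2 (hmin x ⟨⟨hx.1, h0⟩, hx.2.le.trans hbX⟩) hx.2
    have hμp := besselJ_pos_of_ne_zero (b := b) hμ fun x hx h0 =>
      not_lt.2 (hc x ⟨hx.1, h0⟩) hx.2
    have hlim : Tendsto (fun x => besselK ν x * besselJ μ x - besselJ ν x * besselK μ x)
        (𝓝[>] 0) (𝓝 0) := by
      have h1 := (tendsto_besselK_zero hν).mul
        (((continuous_besselJ hμ).tendsto 0).mono_left nhdsWithin_le_nhds)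
      have h2 := (((continuous_besselJ hν).tendsto 0).mono_left nhdsWithin_le_nhds).mul
        (tendsto_besselK_zero hμ)
      simpa using h1.sub h2
    have hW := wronskian_pos (p := fun x => x ^ 2 - ν ^ 2) (q := fun x => x ^ 2 - μ ^ 2) hb
      (fun x hx => hasDerivAt_besselJ hν hx.1) (fun x hx => hasDerivAt_besselK hν hx.1)
      (fun x hx => hasDerivAt_besselJ hμ hx.1) (fun x hx => hasDerivAt_besselK hμ hx.1)
      (fun x _ => hpq x) hνp hμp hlim
    have h2 := (hasDerivAt_besselJ hν hb).nonpos_of_pos_left hb hJb hνp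
    have h4 := nonneg_of_pos_left hb (hasDerivAt_besselJ hμ hb).continuousAt hμp
    have h2' : besselK ν b ≤ 0 := by
      have := mul_nonpos_of_nonpos_of_nonneg h2 hb.le; rwa [div_mul_cancel₀ _ hb.ne'] at this
    rw [hJb] at hW
    nlinarith [mul_nonneg (neg_nonneg.2 h2') h4]
  · rintro a ⟨⟨ha, hJa⟩, haX⟩ b ⟨⟨hb, hJb⟩, hbX⟩ hab hcons
    obtain ⟨c, hc, hc0⟩ := sturm_exists_zero (p := fun x => x ^ 2 - ν ^ 2)
      (q := fun x => x ^ 2 - μ ^ 2) ha hab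
      (fun x hx => hasDerivAt_besselJ hν (ha.trans_le hx.1))
      (fun x hx => hasDerivAt_besselK hν (ha.trans_le hx.1))
      (fun x hx => hasDerivAt_besselJ hμ (ha.trans_le hx.1))
      (fun x hx => hasDerivAt_besselK hμ (ha.trans_le hx.1))
      (fun x _ => hpq x) hJa hJb fun x hx h0 => by
        rcases hcons x ⟨⟨ha.trans hx.1, h0⟩, hx.2.le.trans hbX⟩ with h | h
        · exact not_lt.2 h hx.1
        · exact not_lt.2 h hx.2
    exact ⟨c, ⟨ha.trans hc.1, hc0⟩, hc.1.le, hc.2⟩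

/-- Rolle's theorem for the series part of J_ν, whose derivative is a multiple of that of J_{ν+1}.
The point 0 is adjoined to serve the first zero of J_ν and costs the extra 1. -/
theorem besselCount_le_succ {ν : ℝ} (hν : 0 ≤ ν) (X : ℝ) :
    besselCount ν X ≤ besselCount (ν + 1) X + 1 := by
  have hfin := finite_besselZeros (ν := ν + 1) (by positivity) X
  have hsub : insert 0 (besselZeros (ν + 1)) ∩ Iic X ⊆ insert 0 (besselZeros (ν + 1) ∩ Iic X) := by
    rintro x ⟨rfl | hx, hX⟩
    · exact mem_insert _ _
    · exact mem_insert_of_mem _ ⟨hx, hX⟩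
  refine (ncard_le_of_interlace (S := insert 0 (besselZeros (ν + 1))) (finite_besselZeros hν X)
    (fun b hb => hb.2) ((hfin.insert 0).subset hsub) ?_ ?_).trans
    ((ncard_le_ncard hsub (hfin.insert 0)).trans (ncard_insert_le _ _))
  · exact fun b hb _ => ⟨0, mem_insert _ _, hb.1.1⟩
  · rintro a ⟨⟨ha, hJa⟩, haX⟩ b ⟨⟨hb, hJb⟩, hbX⟩ hab -
    have hd (x : ℝ) : HasDerivAt (fun x : ℝ => besselSeries ν ((x / 2) ^ 2))
        (-besselSeries (ν + 1) ((x / 2) ^ 2) * (2 * (x / 2) * (1 / 2))) x := by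
      refine (hasDerivAt_besselSeries hν _).comp x ?_
      simpa using ((hasDerivAt_id x).div_const 2).fun_pow 2
    rw [besselJ_eq] at hJa hJb
    have hA := (mul_eq_zero.1 hJa).resolve_left (by positivity)
    have hB := (mul_eq_zero.1 hJb).resolve_left (by positivity)
    obtain ⟨c, hc, hc0⟩ := exists_hasDerivAt_eq_zero hab
      (fun x _ => (hd x).continuousAt.continuousWithinAt) (by simp only [hA, hB])
      (fun x _ => hd x)
    have hcp : 0 < c := ha.trans hc.1
    refine ⟨c, mem_insert_of_mem _ ⟨hcp, ?_⟩, hc.1.le, hc.2⟩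
    have h0 : besselSeries (ν + 1) ((c / 2) ^ 2) = 0 := by
      have := (mul_eq_zero.1 hc0).resolve_right (by positivity)
      linarith
    rw [besselJ_eq, h0, mul_zero]

/-- Rolle's theorem supplies a zero of J_ν' strictly before each zero of J_ν, and c itself is left
over. For the first zero, J_ν(0) = 0 is used if ν > 0, and the conventional zero at the origin if ν
= 0. -/
theorem besselCount_lt_besselDerivCount {ν c : ℝ} (hν : 0 ≤ ν) (hc : 0 < c)
    (hK : besselK ν c = 0) : besselCount ν c < besselDerivCount ν c := by
  have hfin := finite_besselDerivZeros hν c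
  have hmem : c ∈ besselDerivZeros ν := (mem_besselDerivZeros_of_pos hν hc).2 hK
  have hdiff : (besselDerivZeros ν \ {c}) ∩ Iic c = (besselDerivZeros ν ∩ Iic c) \ {c} := by
    ext x; simp; tauto
  have hle : besselCount ν c ≤ ((besselDerivZeros ν \ {c}) ∩ Iic c).ncard := by
    refine ncard_le_of_interlace (finite_besselZeros hν c) (fun b hb => hb.2)
      (hdiff ▸ hfin.subset sdiff_subset) ?_ ?_
    · rintro b ⟨⟨hb, hJb⟩, hbc⟩ -
      rcases hν.eq_or_lt with rfl | hν0
      · exact ⟨0, ⟨Or.inr ⟨rfl, rfl⟩, hc.ne⟩, hb⟩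
      · obtain ⟨d, hd, hd0⟩ := exists_deriv_eq_zero hb
          (continuous_besselJ hν).continuousOn (by rw [besselJ_at_zero hν0, hJb])
        exact ⟨d, ⟨Or.inl ⟨hd.1, hd0⟩, (hd.2.trans_le hbc).ne⟩, hd.2⟩
    · rintro a ⟨⟨ha, hJa⟩, hac⟩ b ⟨⟨hb, hJb⟩, hbc⟩ hab -
      obtain ⟨d, hd, hd0⟩ := exists_deriv_eq_zero hab
        (continuous_besselJ hν).continuousOn (by rw [hJa, hJb])
      exact ⟨d, ⟨Or.inl ⟨ha.trans hd.1, hd0⟩, (hd.2.trans_le hbc).ne⟩, hd.1.le, hd.2⟩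
  rw [hdiff] at hle
  exact hle.trans_lt (ncard_sdiff_singleton_lt_of_mem ⟨hmem, le_refl c⟩ hfin)

/-- Below the turning point x² - ν² < 0, so J_ν is compared with the constant solution 1 of the
equation with coefficient 0. A first zero b ≤ ν would give x J_ν' > 0 at b, but J_ν comes down to
zero there. -/
theorem besselJ_ne_zero_of_le {ν x : ℝ} (hν : 0 ≤ ν) (hx : 0 < x) (hxν : x ≤ ν) :
    besselJ ν x ≠ 0 := by
  intro hJ
  obtain ⟨b, ⟨⟨hb, hJb⟩, hbx⟩, hmin⟩ :=
    (finite_besselZeros hν x).exists_minimal ⟨x, ⟨hx, hJ⟩, le_refl x⟩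
  have hbν : b ≤ ν := (show b ≤ x from hbx).trans hxν
  have hp := besselJ_pos_of_ne_zero (b := b) hν fun y hy h0 =>
    not_lt.2 (hmin ⟨⟨hy.1, h0⟩, hy.2.le.trans hbx⟩ hy.2.le) hy.2
  have hW := wronskian_pos (f := besselJ ν) (F := besselK ν) (g := fun _ => 1) (G := fun _ => 0)
    (p := fun x => x ^ 2 - ν ^ 2) (q := fun _ => 0) hb
    (fun y hy => hasDerivAt_besselJ hν hy.1) (fun y hy => hasDerivAt_besselK hν hy.1)
    (fun y _ => (hasDerivAt_const y (1 : ℝ)).congr_deriv (by simp))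
    (fun y _ => (hasDerivAt_const y (0 : ℝ)).congr_deriv (by simp))
    (fun y hy => by have := hy.2.trans_le hbν; nlinarith [hy.1]) hp (fun _ _ => one_pos)
    (by simpa using tendsto_besselK_zero hν)
  have h2 := (hasDerivAt_besselJ hν hb).nonpos_of_pos_left hb hJb hp
  have h3 := mul_nonpos_of_nonpos_of_nonneg h2 hb.le
  rw [div_mul_cancel₀ _ hb.ne'] at h3
  simp only [mul_one, mul_zero, sub_zero] at hW
  linarith

/-! ### The Liouville–Green phase -/

/-- The Liouville–Green phase `√(x² - ν²) - ν arccos (ν / x)` of the Bessel equation. -/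
noncomputable def besselPhase (ν x : ℝ) : ℝ :=
  Real.sqrt (x ^ 2 - ν ^ 2) - ν * Real.arccos (ν / x)

theorem hasDerivAt_sqrt_sq_sub {ν x : ℝ} (hν : 0 ≤ ν) (hx : ν < x) :
    HasDerivAt (fun x => Real.sqrt (x ^ 2 - ν ^ 2)) (x / Real.sqrt (x ^ 2 - ν ^ 2)) x := by
  have hQ : 0 < x ^ 2 - ν ^ 2 := by nlinarith
  have h : HasDerivAt (fun x => x ^ 2 - ν ^ 2) (2 * x) x := by
    simpa using (hasDerivAt_pow 2 x).sub_const (ν ^ 2)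
  refine (h.sqrt hQ.ne').congr_deriv ?_
  have := Real.sqrt_pos.2 hQ
  field_simp

theorem hasDerivAt_besselPhase {ν x : ℝ} (hν : 0 ≤ ν) (hx : ν < x) :
    HasDerivAt (besselPhase ν) (Real.sqrt (x ^ 2 - ν ^ 2) / x) x := by
  have hQ : 0 < x ^ 2 - ν ^ 2 := by nlinarith
  have hx0 : 0 < x := hν.trans_lt hx
  have hR := Real.sqrt_pos.2 hQ
  have hR2 := Real.sq_sqrt hQ.le
  have h1 := hasDerivAt_sqrt_sq_sub hν hx
  have h2 : HasDerivAt (fun x => ν / x) (-ν / x ^ 2) x := by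
    simpa [div_eq_mul_inv] using (hasDerivAt_inv hx0.ne').const_mul ν
  have hlt : ν / x < 1 := (div_lt_one hx0).2 hx
  have hge : 0 ≤ ν / x := by positivity
  have h3 := (Real.hasDerivAt_arccos (by linarith : ν / x ≠ -1) hlt.ne).comp x h2
  refine (h1.sub (h3.const_mul ν)).congr_deriv ?_
  have h4 : Real.sqrt (1 - (ν / x) ^ 2) = Real.sqrt (x ^ 2 - ν ^ 2) / x := by
    rw [show 1 - (ν / x) ^ 2 = (x ^ 2 - ν ^ 2) / x ^ 2 by field_simp, Real.sqrt_div hQ.le,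
      Real.sqrt_sq hx0.le]
  rw [h4]
  field_simp
  linear_combination -hR2

theorem continuousOn_besselPhase {ν : ℝ} (hν : 0 ≤ ν) : ContinuousOn (besselPhase ν) (Ioi ν) :=
  fun _ hx => (hasDerivAt_besselPhase hν hx).continuousAt.continuousWithinAt

theorem strictMonoOn_besselPhase {ν : ℝ} (hν : 0 ≤ ν) : StrictMonoOn (besselPhase ν) (Ioi ν) := by
  refine strictMonoOn_of_deriv_pos (convex_Ioi ν) (continuousOn_besselPhase hν) fun x hx => ?_
  rw [interior_Ioi] at hx
  have hx' : ν < x := hx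
  have hQ : 0 < x ^ 2 - ν ^ 2 := by nlinarith
  rw [(hasDerivAt_besselPhase hν hx).deriv]
  exact div_pos (Real.sqrt_pos.2 hQ) (hν.trans_lt hx)

theorem tendsto_besselPhase_sub {ν : ℝ} (hν : 0 ≤ ν) :
    Tendsto (fun x => besselPhase ν x - (x - ν * Real.pi / 2)) atTop (𝓝 0) := by
  have h0 : Tendsto (fun x : ℝ => ν ^ 2 / x) atTop (𝓝 0) := tendsto_id.const_div_atTop _
  have h1 : Tendsto (fun x => x - Real.sqrt (x ^ 2 - ν ^ 2)) atTop (𝓝 0) := by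
    refine squeeze_zero' ?_ ?_ h0
    · filter_upwards [eventually_gt_atTop 0] with x hx
      exact sub_nonneg.2 (Real.sqrt_le_iff.2 ⟨hx.le, by nlinarith [sq_nonneg ν]⟩)
    · filter_upwards [eventually_gt_atTop 0, eventually_ge_atTop ν] with x hx hxν
      rw [sub_le_comm]
      refine Real.le_sqrt_of_sq_le ?_
      have h2 : ν ^ 2 / x * x = ν ^ 2 := by field_simp
      have h3 : ν ^ 2 / x ≤ x := by rw [div_le_iff₀ hx]; nlinarith
      have h4 : 0 ≤ ν ^ 2 / x := by positivity
      nlinarith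
  have h2 : Tendsto (fun x => Real.arccos (ν / x)) atTop (𝓝 (Real.pi / 2)) := by
    rw [← Real.arccos_zero]
    exact (Real.continuous_arccos.tendsto 0).comp (tendsto_id.const_div_atTop ν)
  have h3 := (h1.neg).sub ((h2.sub_const (Real.pi / 2)).const_mul ν)
  rw [sub_self, mul_zero, sub_zero, neg_zero] at h3
  refine h3.congr fun x => ?_
  rw [besselPhase]; ring

theorem tendsto_besselPhase_atTop {ν : ℝ} (hν : 0 ≤ ν) :
    Tendsto (besselPhase ν) atTop atTop := by
  have h := (tendsto_besselPhase_sub hν).add_atTop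
    (tendsto_atTop_add_const_right atTop (-(ν * Real.pi / 2)) tendsto_id)
  refine h.congr fun x => ?_
  simp only [id]; ring

theorem exists_besselPhase_eq_add {ν x c : ℝ} (hν : 0 ≤ ν) (hx : ν < x) (hc : 0 ≤ c) :
    ∃ y, x ≤ y ∧ besselPhase ν y = besselPhase ν x + c := by
  obtain ⟨X, hX, hxX⟩ := (((tendsto_besselPhase_atTop hν).eventually_ge_atTop
    (besselPhase ν x + c)).and (eventually_ge_atTop x)).exists
  obtain ⟨y, hy, hyc⟩ := intermediate_value_Icc hxX
    ((continuousOn_besselPhase hν).mono fun z hz => hx.trans_le hz.1)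
    (⟨by linarith, hX⟩ : besselPhase ν x + c ∈ Icc (besselPhase ν x) (besselPhase ν X))
  exact ⟨y, hy.1, hyc⟩

/-! ### Comparison with the Liouville–Green functions -/

/-- The Liouville–Green approximant `(x² - ν²)^(-1/4) sin (s(x) - c)` with phase `s`. -/
noncomputable def liouvilleGreen (ν c x : ℝ) : ℝ :=
  (x ^ 2 - ν ^ 2) ^ (-(1 / 4) : ℝ) * Real.sin (besselPhase ν x - c)

/-- `x d/dx` of `liouvilleGreen`. -/
noncomputable def liouvilleGreenD (ν c x : ℝ) : ℝ :=
  (x ^ 2 - ν ^ 2) ^ (-(1 / 4) : ℝ) *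
    (Real.sqrt (x ^ 2 - ν ^ 2) * Real.cos (besselPhase ν x - c) -
      x ^ 2 / (2 * Real.sqrt (x ^ 2 - ν ^ 2) ^ 2) * Real.sin (besselPhase ν x - c))

/-- The coefficient of the equation satisfied by `liouvilleGreen`. -/
noncomputable def liouvilleGreenCoeff (ν x : ℝ) : ℝ :=
  (x ^ 2 - ν ^ 2) - (5 / 4 * x ^ 4 - x ^ 2 * (x ^ 2 - ν ^ 2)) / (x ^ 2 - ν ^ 2) ^ 2

theorem hasDerivAt_rpow_sq_sub {ν x : ℝ} (hν : 0 ≤ ν) (hx : ν < x) :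
    HasDerivAt (fun x : ℝ => (x ^ 2 - ν ^ 2) ^ (-(1 / 4) : ℝ))
      (-x / (2 * (x ^ 2 - ν ^ 2)) * (x ^ 2 - ν ^ 2) ^ (-(1 / 4) : ℝ)) x := by
  have hQ : 0 < x ^ 2 - ν ^ 2 := by nlinarith
  have h : HasDerivAt (fun x => x ^ 2 - ν ^ 2) (2 * x) x := by
    simpa using (hasDerivAt_pow 2 x).sub_const (ν ^ 2)
  refine (h.rpow_const (p := -(1 / 4)) (Or.inl hQ.ne')).congr_deriv ?_
  rw [Real.rpow_sub_one hQ.ne']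
  field_simp
  ring

theorem hasDerivAt_liouvilleGreen {ν c x : ℝ} (hν : 0 ≤ ν) (hx : ν < x) :
    HasDerivAt (liouvilleGreen ν c) (liouvilleGreenD ν c x / x) x := by
  have hQ : 0 < x ^ 2 - ν ^ 2 := by nlinarith
  have hx0 : 0 < x := hν.trans_lt hx
  have hR := Real.sqrt_pos.2 hQ
  have hR2 := Real.sq_sqrt hQ.le
  refine ((hasDerivAt_rpow_sq_sub hν hx).mul
    ((hasDerivAt_besselPhase hν hx).sub_const c).sin).congr_deriv ?_
  rw [liouvilleGreenD, hR2]
  field_simp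
  ring

theorem hasDerivAt_liouvilleGreenD {ν c x : ℝ} (hν : 0 ≤ ν) (hx : ν < x) :
    HasDerivAt (liouvilleGreenD ν c)
      (-liouvilleGreenCoeff ν x * liouvilleGreen ν c x / x) x := by
  have hQ : 0 < x ^ 2 - ν ^ 2 := by nlinarith
  have hx0 : 0 < x := hν.trans_lt hx
  have hR := Real.sqrt_pos.2 hQ
  have hR2 := Real.sq_sqrt hQ.le
  have hs := (hasDerivAt_besselPhase hν hx).sub_const c
  have hr := hasDerivAt_sqrt_sq_sub hν hx
  have h1 := (hasDerivAt_pow 2 x).fun_div ((hr.fun_pow 2).const_mul 2) (by positivity)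
  refine ((hasDerivAt_rpow_sq_sub hν hx).mul
    ((hr.fun_mul hs.cos).fun_sub (h1.fun_mul hs.sin))).congr_deriv ?_
  rw [liouvilleGreenCoeff, liouvilleGreen]
  generalize (x ^ 2 - ν ^ 2) ^ (-(1 / 4) : ℝ) = m at *
  generalize Real.sqrt (x ^ 2 - ν ^ 2) = R at *
  rw [← hR2]
  field_simp
  ring

/-- The equation for xJ_ν' has a first-order term; division by √(x² - ν²) removes it, so that the
quotient is accessible to Sturm comparison. The second half of the system is
`hasDerivAt_besselK_div'`. -/
theorem hasDerivAt_besselK_div {ν x : ℝ} (hν : 0 ≤ ν) (hx : ν < x) :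
    HasDerivAt (fun x => besselK ν x / Real.sqrt (x ^ 2 - ν ^ 2))
      ((-Real.sqrt (x ^ 2 - ν ^ 2) * besselJ ν x -
        x ^ 2 * besselK ν x / Real.sqrt (x ^ 2 - ν ^ 2) ^ 3) / x) x := by
  have hQ : 0 < x ^ 2 - ν ^ 2 := by nlinarith
  have hx0 : 0 < x := hν.trans_lt hx
  have hR := Real.sqrt_pos.2 hQ
  have hR2 := Real.sq_sqrt hQ.le
  refine ((hasDerivAt_besselK hν hx0).fun_div (hasDerivAt_sqrt_sq_sub hν hx)
    hR.ne').congr_deriv ?_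
  generalize Real.sqrt (x ^ 2 - ν ^ 2) = R at *
  rw [← hR2]
  field_simp

theorem hasDerivAt_besselK_div' {ν x : ℝ} (hν : 0 ≤ ν) (hx : ν < x) :
    HasDerivAt (fun x => -Real.sqrt (x ^ 2 - ν ^ 2) * besselJ ν x -
        x ^ 2 * besselK ν x / Real.sqrt (x ^ 2 - ν ^ 2) ^ 3)
      (-((x ^ 2 - ν ^ 2) + 2 * x ^ 2 / (x ^ 2 - ν ^ 2) - 3 * x ^ 4 / (x ^ 2 - ν ^ 2) ^ 2) *
        (besselK ν x / Real.sqrt (x ^ 2 - ν ^ 2)) / x) x := by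
  have hQ : 0 < x ^ 2 - ν ^ 2 := by nlinarith
  have hx0 : 0 < x := hν.trans_lt hx
  have hR := Real.sqrt_pos.2 hQ
  have hR2 := Real.sq_sqrt hQ.le
  have hr := hasDerivAt_sqrt_sq_sub hν hx
  refine ((hr.fun_neg.fun_mul (hasDerivAt_besselJ hν hx0)).fun_sub
    (((hasDerivAt_pow 2 x).fun_mul (hasDerivAt_besselK hν hx0)).fun_div (hr.fun_pow 3)
      (by positivity))).congr_deriv ?_
  generalize Real.sqrt (x ^ 2 - ν ^ 2) = R at *
  rw [← hR2]
  field_simp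
  ring

theorem liouvilleGreen_ne_zero {ν c x : ℝ} (hν : 0 ≤ ν) (hx : ν < x) (h0 : c < besselPhase ν x)
    (h1 : besselPhase ν x < c + Real.pi) : liouvilleGreen ν c x ≠ 0 := by
  have hQ : 0 < x ^ 2 - ν ^ 2 := by nlinarith
  exact (mul_pos (Real.rpow_pos_of_pos hQ _)
    (Real.sin_pos_of_pos_of_lt_pi (by linarith) (by linarith))).ne'

theorem exists_besselJ_zero {ν a b : ℝ} (hν : 0 ≤ ν) (ha : ν < a) (hab : a < b)
    (hs : besselPhase ν b = besselPhase ν a + Real.pi) : ∃ c ∈ Ioo a b, besselJ ν c = 0 := by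
  have hx {x : ℝ} (h : x ∈ Icc a b) : ν < x := ha.trans_le h.1
  have hx0 {x : ℝ} (h : x ∈ Icc a b) : 0 < x := hν.trans_lt (hx h)
  have hm := strictMonoOn_besselPhase hν
  refine sturm_exists_zero (f := liouvilleGreen ν (besselPhase ν a)) (p := liouvilleGreenCoeff ν)
    (q := fun x => x ^ 2 - ν ^ 2) (hν.trans_lt ha) hab
    (fun x h => hasDerivAt_liouvilleGreen hν (hx h))
    (fun x h => hasDerivAt_liouvilleGreenD hν (hx h))
    (fun x h => hasDerivAt_besselJ hν (hx0 h)) (fun x h => hasDerivAt_besselK hν (hx0 h))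
    (fun x h => ?_) (by simp [liouvilleGreen]) (by simp [liouvilleGreen, hs]) fun x h => ?_
  · have h1 := hx (Ioo_subset_Icc_self h)
    have h2 := hx0 (Ioo_subset_Icc_self h)
    have hQ : 0 < x ^ 2 - ν ^ 2 := by nlinarith
    -- The numerator is x⁴/4 + x²ν².
    have : 0 < (5 / 4 * x ^ 4 - x ^ 2 * (x ^ 2 - ν ^ 2)) / (x ^ 2 - ν ^ 2) ^ 2 := by
      refine div_pos ?_ (by positivity)
      have : 0 < x ^ 4 := by positivity
      have : 0 ≤ x ^ 2 * ν ^ 2 := by positivity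
      nlinarith
    rw [liouvilleGreenCoeff]; linarith
  · have h1 := hx (Ioo_subset_Icc_self h)
    refine liouvilleGreen_ne_zero hν h1 (hm ha h1 h.1) ?_
    rw [← hs]
    exact hm h1 (ha.trans hab) h.2

/-- Here the Liouville–Green function is the faster one. It must vanish between the two zeros, but
started at phase s(a) it has no zero before the phase has grown by π. -/
theorem besselPhase_gap_of_consecutive {ν a b : ℝ} (hν : 0 ≤ ν) (ha : ν < a) (hab : a < b)
    (hKa : besselK ν a = 0) (hKb : besselK ν b = 0) (hK : ∀ x ∈ Ioo a b, besselK ν x ≠ 0) :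
    besselPhase ν a + Real.pi < besselPhase ν b := by
  by_contra! hs
  have hx {x : ℝ} (h : x ∈ Icc a b) : ν < x := ha.trans_le h.1
  have hm := strictMonoOn_besselPhase hν
  have hz : ∃ c ∈ Ioo a b, liouvilleGreen ν (besselPhase ν a) c = 0 := by
    refine sturm_exists_zero
      (f := fun x => besselK ν x / Real.sqrt (x ^ 2 - ν ^ 2))
      (F := fun x => -Real.sqrt (x ^ 2 - ν ^ 2) * besselJ ν x -
          x ^ 2 * besselK ν x / Real.sqrt (x ^ 2 - ν ^ 2) ^ 3)
      (p := fun x => (x ^ 2 - ν ^ 2) + 2 * x ^ 2 / (x ^ 2 - ν ^ 2) - 3 * x ^ 4 / (x ^ 2 - ν ^ 2) ^ 2)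
      (g := liouvilleGreen ν (besselPhase ν a)) (q := liouvilleGreenCoeff ν)
      (hν.trans_lt ha) hab
      (fun x h => hasDerivAt_besselK_div hν (hx h))
      (fun x h => hasDerivAt_besselK_div' hν (hx h))
      (fun x h => hasDerivAt_liouvilleGreen hν (hx h))
      (fun x h => hasDerivAt_liouvilleGreenD hν (hx h))
      (fun x h => ?_) (by simp [hKa]) (by simp [hKb]) fun x h => ?_
    · have h1 := hx (Ioo_subset_Icc_self h)
      have h2 : 0 < x := hν.trans_lt h1
      have hQ : 0 < x ^ 2 - ν ^ 2 := by nlinarith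
      have h3 : (x ^ 2 - ν ^ 2) + 2 * x ^ 2 / (x ^ 2 - ν ^ 2) - 3 * x ^ 4 / (x ^ 2 - ν ^ 2) ^ 2 =
          liouvilleGreenCoeff ν x -
            (7 / 4 * x ^ 4 - x ^ 2 * (x ^ 2 - ν ^ 2)) / (x ^ 2 - ν ^ 2) ^ 2 := by
        rw [liouvilleGreenCoeff]; field_simp; ring
      -- The numerator is 3x⁴/4 + x²ν².
      have : 0 < (7 / 4 * x ^ 4 - x ^ 2 * (x ^ 2 - ν ^ 2)) / (x ^ 2 - ν ^ 2) ^ 2 := by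
        refine div_pos ?_ (by positivity)
        have : 0 < x ^ 4 := by positivity
        have : 0 ≤ x ^ 2 * ν ^ 2 := by positivity
        nlinarith
      simp only [h3]; linarith
    · have h1 := hx (Ioo_subset_Icc_self h)
      have hQ : 0 < x ^ 2 - ν ^ 2 := by nlinarith
      exact div_ne_zero (hK x h) (Real.sqrt_pos.2 hQ).ne'
  obtain ⟨c, hc, hc0⟩ := hz
  have h1 := hx (Ioo_subset_Icc_self hc)
  exact liouvilleGreen_ne_zero hν h1 (hm ha h1 hc.1)
    ((hm h1 (ha.trans hab) hc.2).trans_le hs) hc0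

theorem besselPhase_gap {ν a b : ℝ} (hν : 0 ≤ ν) (ha : ν < a) (hab : a < b)
    (hKa : besselK ν a = 0) (hKb : besselK ν b = 0) :
    besselPhase ν a + Real.pi < besselPhase ν b := by
  have ha0 : 0 < a := hν.trans_lt ha
  have hfin : (besselDerivZeros ν ∩ Ioc a b).Finite :=
    (finite_besselDerivZeros hν b).subset fun x hx => ⟨hx.1, hx.2.2⟩
  obtain ⟨d, ⟨hd, hda, hdb⟩, hmin⟩ := hfin.exists_minimal
    ⟨b, (mem_besselDerivZeros_of_pos hν (ha0.trans hab)).2 hKb, hab, le_rfl⟩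
  refine (besselPhase_gap_of_consecutive hν ha hda hKa
    ((mem_besselDerivZeros_of_pos hν (ha0.trans hda)).1 hd) fun x hx h0 => ?_).trans_le
    ((strictMonoOn_besselPhase hν).monotoneOn (ha.trans hda) (ha.trans hab) hdb)
  exact not_lt.2 (hmin ⟨(mem_besselDerivZeros_of_pos hν (ha0.trans hx.1)).2 h0, hx.1,
    hx.2.le.trans hdb⟩ hx.2.le) hx.2

/-! ### Counts along phase steps of π -/

theorem exists_besselCount_add_le {ν a : ℝ} (hν : 0 ≤ ν) (ha : ν < a) (m : ℕ) :
    ∃ b, a ≤ b ∧ besselPhase ν b = besselPhase ν a + m * Real.pi ∧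
      besselCount ν a + m ≤ besselCount ν b := by
  induction m with
  | zero => exact ⟨a, le_rfl, by simp, by simp⟩
  | succ m ih =>
    obtain ⟨b, hab, hs, hN⟩ := ih
    have hb := ha.trans_le hab
    obtain ⟨d, hbd, hd⟩ := exists_besselPhase_eq_add hν hb Real.pi_pos.le
    have hbd' : b < d := hbd.lt_of_ne fun h => by
      rw [← h] at hd; linarith [Real.pi_pos]
    obtain ⟨c, hc, hc0⟩ := exists_besselJ_zero hν hb hbd' hd
    refine ⟨d, hab.trans hbd, by rw [hd, hs]; push_cast; ring, ?_⟩
    have : besselCount ν b < besselCount ν d := by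
      refine ncard_lt_ncard ⟨inter_subset_inter_right _ (Iic_subset_Iic.2 hbd), fun h => ?_⟩
        (finite_besselZeros hν d)
      exact not_le.2 hc.1 (h ⟨⟨(hν.trans_lt hb).trans hc.1, hc0⟩, hc.2.le⟩).2
    omega

theorem exists_besselDerivCount_le_add {ν a : ℝ} (hν : 0 ≤ ν) (ha : ν < a) (m : ℕ) :
    ∃ b, a ≤ b ∧ besselPhase ν b = besselPhase ν a + m * Real.pi ∧
      besselDerivCount ν b ≤ besselDerivCount ν a + m := by
  induction m with
  | zero => exact ⟨a, le_rfl, by simp, by simp⟩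
  | succ m ih =>
    obtain ⟨b, hab, hs, hN⟩ := ih
    have hb := ha.trans_le hab
    have hb0 := hν.trans_lt hb
    obtain ⟨d, hbd, hd⟩ := exists_besselPhase_eq_add hν hb Real.pi_pos.le
    refine ⟨d, hab.trans hbd, by rw [hd, hs]; push_cast; ring, ?_⟩
    have hmono := (strictMonoOn_besselPhase hν).monotoneOn
    have hsub : (besselDerivZeros ν ∩ Ioc b d).ncard ≤ 1 := by
      have hle : ∀ x ∈ besselDerivZeros ν ∩ Ioc b d, ∀ y ∈ besselDerivZeros ν ∩ Ioc b d,
          ¬ x < y := by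
        rintro x ⟨hx, hbx, hxd⟩ y ⟨hy, hby, hyd⟩ hxy
        have h1 := besselPhase_gap hν (hb.trans hbx) hxy
          ((mem_besselDerivZeros_of_pos hν (hb0.trans hbx)).1 hx)
          ((mem_besselDerivZeros_of_pos hν (hb0.trans hby)).1 hy)
        have h2 := hmono hb (hb.trans hbx) hbx.le
        have h3 := hmono (hb.trans hby) (hb.trans_le hbd) hyd
        linarith
      rw [ncard_le_one ((finite_besselDerivZeros hν d).subset fun x hx => ⟨hx.1, hx.2.2⟩)]
      intro x hx y hy
      exact le_antisymm (not_lt.1 (hle y hy x hx)) (not_lt.1 (hle x hx y hy))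
    have hun : besselDerivZeros ν ∩ Iic d =
        (besselDerivZeros ν ∩ Iic b) ∪ (besselDerivZeros ν ∩ Ioc b d) := by
      rw [← inter_union_distrib_left, Iic_union_Ioc_eq_Iic hbd]
    have : besselDerivCount ν d ≤ besselDerivCount ν b + 1 := by
      rw [besselDerivCount, hun]
      exact (ncard_union_le _ _).trans (Nat.add_le_add_left hsub _)
    omega

/-! ### Poisson's integral -/

/-- The even moments of the weight `(1 - t²)^a` on `[-1, 1]`. -/
noncomputable def jacobiMoment (a : ℝ) (m : ℕ) : ℝ :=
  ∫ t in (-1 : ℝ)..1, t ^ (2 * m) * (1 - t ^ 2) ^ a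

theorem continuous_jacobiWeight {a : ℝ} (ha : 0 ≤ a) :
    Continuous fun t : ℝ => (1 - t ^ 2) ^ a :=
  (by fun_prop : Continuous fun t : ℝ => 1 - t ^ 2).rpow_const fun _ => Or.inr ha

/-- Integrate the derivative of t^(2m+1) (1 - t²)^(a+1), which vanishes at ±1. -/
theorem jacobiMoment_succ {a : ℝ} (ha : 0 < a) (m : ℕ) :
    (m + a + 3 / 2) * jacobiMoment a (m + 1) = (m + 1 / 2) * jacobiMoment a m := by
  have hw := continuous_jacobiWeight ha.le
  have hd (t : ℝ) : HasDerivAt (fun t : ℝ => t ^ (2 * m + 1) * (1 - t ^ 2) ^ (a + 1))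
      ((2 * m + 1) * t ^ (2 * m) * (1 - t ^ 2) ^ (a + 1) +
        t ^ (2 * m + 1) * (-(2 * t) * (a + 1) * (1 - t ^ 2) ^ a)) t := by
    have h1 : HasDerivAt (fun t : ℝ => 1 - t ^ 2) (-(2 * t)) t := by
      simpa using (hasDerivAt_pow 2 t).const_sub 1
    have h2 := h1.rpow_const (p := a + 1) (Or.inr (by linarith))
    refine ((hasDerivAt_pow (2 * m + 1) t).mul h2).congr_deriv ?_
    simp only [add_sub_cancel_right, Nat.add_sub_cancel]
    push_cast; ring
  have hI := intervalIntegral.integral_eq_sub_of_hasDerivAt (a := -1) (b := 1) (fun t _ => hd t)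
    (Continuous.intervalIntegrable (by
      have := continuous_jacobiWeight (a := a + 1) (by positivity)
      fun_prop) _ _)
  have h0 : (0 : ℝ) ^ (a + 1) = 0 := Real.zero_rpow (by positivity)
  simp only [one_pow, sub_self, h0, mul_zero, even_two.neg_pow] at hI
  have hcongr : (∫ t in (-1 : ℝ)..1, ((2 * m + 1) * t ^ (2 * m) * (1 - t ^ 2) ^ (a + 1) +
        t ^ (2 * m + 1) * (-(2 * t) * (a + 1) * (1 - t ^ 2) ^ a))) =
      ∫ t in (-1 : ℝ)..1, ((2 * m + 1) * (t ^ (2 * m) * (1 - t ^ 2) ^ a) -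
        (2 * m + 2 * a + 3) * (t ^ (2 * (m + 1)) * (1 - t ^ 2) ^ a)) := by
    refine intervalIntegral.integral_congr fun t ht => ?_
    rw [uIcc_of_le (by norm_num)] at ht
    have hnn : 0 ≤ 1 - t ^ 2 := by nlinarith [ht.1, ht.2]
    simp only [Real.rpow_add_one' hnn (by positivity : a + 1 ≠ 0)]
    ring
  rw [hcongr, intervalIntegral.integral_sub
    (Continuous.intervalIntegrable (by fun_prop) _ _)
    (Continuous.intervalIntegrable (by fun_prop) _ _),
    intervalIntegral.integral_const_mul, intervalIntegral.integral_const_mul] at hI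
  unfold jacobiMoment
  linear_combination (-1 / 2) * hI

theorem jacobiMoment_zero_pos {a : ℝ} (ha : 0 < a) : 0 < jacobiMoment a 0 := by
  refine intervalIntegral.intervalIntegral_pos_of_pos_on
    (Continuous.intervalIntegrable (by
      have := continuous_jacobiWeight ha.le
      fun_prop) _ _) (fun t ht => ?_) (by norm_num)
  have hp : 0 < 1 - t ^ 2 := by nlinarith [ht.1, ht.2]
  have := Real.rpow_pos_of_pos hp a
  simpa using this

/-- Both sides obey the same first-order recurrence in m and agree at m = 0, so the moments need not
be evaluated. -/
theorem jacobiMoment_eq {a : ℝ} (ha : 0 < a) (m : ℕ) :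
    (-1) ^ m * jacobiMoment a m / (Nat.factorial (2 * m) : ℝ) =
      jacobiMoment a 0 * Real.Gamma (a + 3 / 2) * (besselCoeff (a + 1 / 2) m / 4 ^ m) := by
  induction m with
  | zero =>
    have h : Real.Gamma (a + 3 / 2) ≠ 0 := (Real.Gamma_pos_of_pos (by positivity)).ne'
    simp [besselCoeff]
    rw [show a + 2⁻¹ + 1 = a + 3 / 2 by ring]
    field_simp
  | succ m ih =>
    have hs := jacobiMoment_succ ha m
    have hm : (m : ℝ) + a + 3 / 2 ≠ 0 := by positivity
    have hs' : jacobiMoment a (m + 1) = (m + 1 / 2) * jacobiMoment a m / (m + a + 3 / 2) := by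
      rw [eq_div_iff hm]; linarith
    rw [besselCoeff_succ (by positivity), hs', show 2 * (m + 1) = 2 * m + 1 + 1 by ring,
      Nat.factorial_succ, Nat.factorial_succ]
    have hf := Nat.factorial_ne_zero (2 * m)
    have hm' : (m : ℝ) + (a + 1 / 2) + 1 ≠ 0 := by positivity
    push_cast
    calc _ = ((-1) ^ m * jacobiMoment a m / (Nat.factorial (2 * m) : ℝ)) *
          (-(m + 1 / 2) / ((m + a + 3 / 2) * (2 * m + 1 + 1) * (2 * m + 1))) := by
          field_simp; ring
      _ = _ := by
          rw [ih, show (m : ℝ) + a + 3 / 2 = m + (a + 1 / 2) + 1 by ring]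
          field_simp
          ring

/-- Poisson's integral for `J_{a + 1/2}`. -/
theorem integral_cos_mul_jacobiWeight {a : ℝ} (ha : 0 < a) (x : ℝ) :
    ∫ t in (-1 : ℝ)..1, Real.cos (x * t) * (1 - t ^ 2) ^ a =
      jacobiMoment a 0 * Real.Gamma (a + 3 / 2) * besselSeries (a + 1 / 2) ((x / 2) ^ 2) := by
  have hw := continuous_jacobiWeight ha.le
  have hsum : HasSum (fun m : ℕ => ∫ t in (-1 : ℝ)..1,
      (-1) ^ m * (x * t) ^ (2 * m) / (Nat.factorial (2 * m) : ℝ) * (1 - t ^ 2) ^ a)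
      (∫ t in (-1 : ℝ)..1, Real.cos (x * t) * (1 - t ^ 2) ^ a) := by
    refine intervalIntegral.hasSum_integral_of_dominated_convergence
      (fun m _ => x ^ (2 * m) / (Nat.factorial (2 * m) : ℝ))
      (fun m => (Continuous.aestronglyMeasurable (by fun_prop)))
      (fun m => Eventually.of_forall fun t ht => ?_)
      (Eventually.of_forall fun t _ => (Real.hasSum_cosh x).summable)
      (by simp) (Eventually.of_forall fun t _ => (Real.hasSum_cos (x * t)).mul_right _)
    rw [uIoc_of_le (by norm_num)] at ht
    have h0 : 0 ≤ 1 - t ^ 2 := by nlinarith [ht.1, ht.2]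
    have h1 : (1 - t ^ 2) ^ a ≤ 1 := Real.rpow_le_one h0 (by nlinarith) ha.le
    have h2 : (t ^ 2) ^ m ≤ 1 := pow_le_one₀ (sq_nonneg t) (by linarith)
    have h3 := Real.rpow_nonneg h0 a
    have hxm : 0 ≤ x ^ (2 * m) := by rw [pow_mul]; positivity
    rw [norm_mul, norm_div, norm_mul, norm_pow, norm_neg, norm_one, one_pow, one_mul,
      Real.norm_natCast, mul_pow, Real.norm_of_nonneg h3, norm_mul, Real.norm_of_nonneg hxm,
      pow_mul t, Real.norm_of_nonneg (by positivity : (0 : ℝ) ≤ (t ^ 2) ^ m)]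
    calc _ ≤ x ^ (2 * m) * 1 / (Nat.factorial (2 * m) : ℝ) * 1 := by gcongr
      _ = _ := by ring
  refine hsum.unique ?_
  refine ((hasSum_besselSeries (ν := a + 1 / 2) (by positivity) ((x / 2) ^ 2)).mul_left
    (jacobiMoment a 0 * Real.Gamma (a + 3 / 2))).congr_fun fun m => ?_
  have hcongr : (∫ t in (-1 : ℝ)..1,
      (-1) ^ m * (x * t) ^ (2 * m) / (Nat.factorial (2 * m) : ℝ) * (1 - t ^ 2) ^ a) =
      x ^ (2 * m) * ((-1) ^ m * jacobiMoment a m / (Nat.factorial (2 * m) : ℝ)) := by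
    rw [show x ^ (2 * m) * ((-1) ^ m * jacobiMoment a m / (Nat.factorial (2 * m) : ℝ)) =
      ((-1) ^ m * x ^ (2 * m) / (Nat.factorial (2 * m) : ℝ)) * jacobiMoment a m by ring,
      jacobiMoment, ← intervalIntegral.integral_const_mul]
    refine intervalIntegral.integral_congr fun t _ => ?_
    simp only [mul_pow]
    ring
  rw [hcongr, jacobiMoment_eq ha, div_pow, pow_mul, div_pow]
  norm_num
  field_simp

/-! ### Contour shift to vertical half-lines -/

/-- On the half-line z = 1 + iy one has 1 - z² = y² - 2iy; rescaling y by x turns the coefficient 1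
into c = 1/x. For c ≥ 0 the base stays in the closed right half-plane, away from the branch cut. -/
theorem continuous_cpow_sub_mul_I {a c : ℝ} (ha : 0 < a) (hc : 0 ≤ c) :
    Continuous fun y : ℝ => ((c * y ^ 2 : ℝ) - 2 * y * Complex.I : ℂ) ^ (a : ℂ) := by
  refine continuous_iff_continuousAt.2 fun y => ?_
  have h := Complex.continuousAt_cpow_const_of_re_pos
    (z := ((c * y ^ 2 : ℝ) - 2 * y * Complex.I : ℂ)) (w := (a : ℂ)) (Or.inl (by
      simp [-Complex.ofReal_mul, -Complex.ofReal_pow]; positivity)) (by simpa)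
  exact ContinuousAt.comp (f := fun y : ℝ => ((c * y ^ 2 : ℝ) - 2 * y * Complex.I : ℂ)) h
    (by fun_prop)

theorem norm_cpow_sub_mul_I_le {a c y : ℝ} (ha : 0 < a) (hc : 0 ≤ c) (hc1 : c ≤ 1) (hy : 0 ≤ y) :
    ‖((c * y ^ 2 : ℝ) - 2 * y * Complex.I : ℂ) ^ (a : ℂ)‖ ≤ ((y + 2) ^ 2) ^ a := by
  rw [Complex.norm_cpow_real]
  refine Real.rpow_le_rpow (norm_nonneg _) ?_ ha.le
  refine (norm_sub_le _ _).trans ?_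
  have h1 : ‖((c * y ^ 2 : ℝ) : ℂ)‖ = c * y ^ 2 := by
    rw [Complex.norm_real, Real.norm_of_nonneg (by positivity)]
  have h2 : ‖(2 * y * Complex.I : ℂ)‖ = 2 * y := by
    simp [abs_of_nonneg hy]
  rw [h1, h2]
  nlinarith [sq_nonneg y]

theorem tendsto_add_two_rpow_mul_exp_neg (a : ℝ) {x : ℝ} (hx : 0 < x) :
    Tendsto (fun y : ℝ => ((y + 2) ^ 2) ^ a * Real.exp (-x * y)) atTop (𝓝 0) := by
  have h := ((tendsto_rpow_mul_exp_neg_mul_atTop_nhds_zero (2 * a) x hx).comp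
    (tendsto_atTop_add_const_right atTop (2 : ℝ) tendsto_id)).mul_const (Real.exp (2 * x))
  rw [zero_mul] at h
  refine h.congr' ?_
  filter_upwards [eventually_ge_atTop 0] with y hy
  simp only [Function.comp, id]
  rw [mul_assoc, ← Real.exp_add, ← Real.rpow_natCast, ← Real.rpow_mul (by positivity)]
  congr 2
  ring

theorem integrableOn_add_two_rpow_mul_exp_neg {a x : ℝ} (ha : 0 < a) (hx : 0 < x) :
    IntegrableOn (fun y : ℝ => ((y + 2) ^ 2) ^ a * Real.exp (-x * y)) (Ioi 0) := by
  refine integrable_of_isBigO_exp_neg (b := x / 2) (by positivity) ?_ ?_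
  · have : Continuous fun y : ℝ => ((y + 2) ^ 2) ^ a :=
      (by fun_prop : Continuous fun y : ℝ => (y + 2) ^ 2).rpow_const fun _ => Or.inr ha.le
    exact Continuous.continuousOn (by fun_prop)
  · have h := (tendsto_add_two_rpow_mul_exp_neg a (half_pos hx)).isBigO_one ℝ
    have h2 := h.mul (Asymptotics.isBigO_refl (fun y : ℝ => Real.exp (-(x / 2) * y)) atTop)
    refine (h2.congr_left fun y => ?_).congr_right fun y => by simp
    rw [mul_assoc, ← Real.exp_add]
    ring_nf

/-- The integrand of the Hankel-type integral over the vertical half-line above `1`. -/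
noncomputable def hankelIntegrand (a x y : ℝ) : ℂ :=
  ((y ^ 2 : ℝ) - 2 * y * Complex.I : ℂ) ^ (a : ℂ) * (Real.exp (-x * y) : ℝ)

theorem continuous_hankelIntegrand {a : ℝ} (ha : 0 < a) (x : ℝ) :
    Continuous (hankelIntegrand a x) := by
  have := continuous_cpow_sub_mul_I ha zero_le_one
  simp only [one_mul] at this
  unfold hankelIntegrand
  fun_prop

theorem norm_hankelIntegrand_le {a y : ℝ} (ha : 0 < a) (x : ℝ) (hy : 0 ≤ y) :
    ‖hankelIntegrand a x y‖ ≤ ((y + 2) ^ 2) ^ a * Real.exp (-x * y) := by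
  have := norm_cpow_sub_mul_I_le ha zero_le_one le_rfl hy
  simp only [one_mul] at this
  rw [hankelIntegrand, norm_mul, Complex.norm_real, Real.norm_of_nonneg (Real.exp_pos _).le]
  gcongr

theorem integrableOn_hankelIntegrand {a x : ℝ} (ha : 0 < a) (hx : 0 < x) :
    IntegrableOn (hankelIntegrand a x) (Ioi 0) := by
  refine (integrableOn_add_two_rpow_mul_exp_neg ha hx).mono'
    (continuous_hankelIntegrand ha x).aestronglyMeasurable ?_
  filter_upwards [ae_restrict_mem measurableSet_Ioi] with y hy
  exact norm_hankelIntegrand_le ha x (le_of_lt hy)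

/-- The integrand `(1 - z²)^a e^{ixz}` of Poisson's integral on the complex plane. -/
noncomputable def poissonIntegrand (a x : ℝ) (z : ℂ) : ℂ :=
  (1 - z ^ 2) ^ (a : ℂ) * Complex.exp (Complex.I * x * z)

theorem one_sub_sq_re (t y : ℝ) : (1 - (t + y * Complex.I : ℂ) ^ 2).re = 1 - t ^ 2 + y ^ 2 := by
  simp [pow_two]; ring

theorem continuousOn_poissonIntegrand {a : ℝ} (ha : 0 < a) (x : ℝ) :
    ContinuousOn (poissonIntegrand a x) {z | -1 ≤ z.re ∧ z.re ≤ 1} := by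
  intro z hz
  have hre := one_sub_sq_re z.re z.im
  rw [Complex.re_add_im] at hre
  have h := Complex.continuousAt_cpow_const_of_re_pos (z := 1 - z ^ 2) (w := (a : ℂ))
    (Or.inl (by rw [hre]; nlinarith [hz.1, hz.2])) (by simpa)
  have h2 : ContinuousAt (fun z : ℂ => (1 - z ^ 2) ^ (a : ℂ)) z :=
    ContinuousAt.comp (f := fun z : ℂ => 1 - z ^ 2) h (by fun_prop)
  exact (h2.mul (by fun_prop)).continuousWithinAt

theorem differentiableAt_poissonIntegrand (a x : ℝ) {z : ℂ} (h1 : -1 < z.re) (h2 : z.re < 1) :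
    DifferentiableAt ℂ (poissonIntegrand a x) z := by
  have hre := one_sub_sq_re z.re z.im
  rw [Complex.re_add_im] at hre
  have hs : 1 - z ^ 2 ∈ Complex.slitPlane := Or.inl (by rw [hre]; nlinarith)
  have h3 : DifferentiableAt ℂ (fun z : ℂ => (1 - z ^ 2) ^ (a : ℂ)) z :=
    DifferentiableAt.cpow (by fun_prop) (by fun_prop) hs
  exact h3.mul (by fun_prop)

theorem poissonIntegrand_one_add (a x y : ℝ) :
    poissonIntegrand a x (1 + y * Complex.I) =
      Complex.exp (Complex.I * x) * hankelIntegrand a x y := by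
  rw [poissonIntegrand, hankelIntegrand, Complex.ofReal_exp]
  rw [mul_left_comm, ← Complex.exp_add]
  congr 2
  · push_cast; ring_nf; simp
  · push_cast; ring_nf; simp; ring

theorem poissonIntegrand_neg_one_add {a : ℝ} (x : ℝ) {y : ℝ} :
    poissonIntegrand a x (-1 + y * Complex.I) =
      (starRingEnd ℂ) (poissonIntegrand a x (1 + y * Complex.I)) := by
  rw [poissonIntegrand, poissonIntegrand, map_mul, ← Complex.exp_conj]
  have hre := one_sub_sq_re 1 y
  push_cast at hre
  have harg : (1 - (1 + y * Complex.I) ^ 2 : ℂ).arg ≠ Real.pi := by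
    intro h
    rw [Complex.arg_eq_pi_iff] at h
    nlinarith [h.1]
  have h := Complex.conj_cpow _ (a : ℂ) harg
  rw [Complex.conj_ofReal] at h
  rw [← h]
  congr 2
  · simp; ring
  · simp; ring

theorem integral_cos_eq_re (a x : ℝ) (ha : 0 < a) :
    ∫ t in (-1 : ℝ)..1, Real.cos (x * t) * (1 - t ^ 2) ^ a =
      (∫ t in (-1 : ℝ)..1, poissonIntegrand a x t).re := by
  have hint : IntervalIntegrable (fun t : ℝ => poissonIntegrand a x t) volume (-1) 1 := by
    refine ContinuousOn.intervalIntegrable ?_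
    refine (continuousOn_poissonIntegrand ha x).comp (by fun_prop) fun t ht => ?_
    rw [uIcc_of_le (by norm_num)] at ht
    simpa using ht
  have := Complex.reCLM.intervalIntegral_comp_comm hint
  rw [← Complex.reCLM_apply, ← this]
  refine intervalIntegral.integral_congr fun t ht => ?_
  rw [uIcc_of_le (by norm_num)] at ht
  have h0 : 0 ≤ 1 - t ^ 2 := by nlinarith [ht.1, ht.2]
  have h1 : (1 - (t : ℂ) ^ 2) ^ (a : ℂ) = (((1 - t ^ 2) ^ a : ℝ) : ℂ) := by
    rw [Complex.ofReal_cpow h0]; push_cast; rfl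
  have h2 : Complex.I * x * t = ((x * t : ℝ) : ℂ) * Complex.I := by push_cast; ring
  simp only [poissonIntegrand, Complex.reCLM_apply]
  rw [h1, Complex.re_ofReal_mul, h2, Complex.exp_ofReal_mul_I_re, mul_comm]

/-- Cauchy's theorem on the rectangle with base [-1, 1] and height Y. The integrands on the vertical
sides are conjugate, so the two sides combine to twice an imaginary part. -/
theorem poisson_contour {a x Y : ℝ} (ha : 0 < a) (hY : 0 ≤ Y) :
    ∫ t in (-1 : ℝ)..1, Real.cos (x * t) * (1 - t ^ 2) ^ a =
      2 * (Complex.exp (Complex.I * x) * ∫ y in (0 : ℝ)..Y, hankelIntegrand a x y).im +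
        (∫ t in (-1 : ℝ)..1, poissonIntegrand a x (t + Y * Complex.I)).re := by
  have h := Complex.integral_boundary_rect_eq_zero_of_continuousOn_of_differentiableOn
    (poissonIntegrand a x) (-1) (1 + Y * Complex.I)
    ((continuousOn_poissonIntegrand ha x).mono fun z hz => by
      have := hz.1
      simpa using this)
    (fun z hz => (differentiableAt_poissonIntegrand a x
      (by have := hz.1.1; simpa using this)
      (by have := hz.1.2; simpa using this)).differentiableWithinAt)
  simp only [Complex.neg_re, Complex.one_re, Complex.add_re, Complex.mul_re, Complex.ofReal_re,
    Complex.I_re, mul_zero, Complex.ofReal_im, Complex.I_im, mul_one, sub_self, add_zero,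
    Complex.neg_im, Complex.one_im, neg_zero, Complex.ofReal_zero, zero_mul, Complex.add_im,
    Complex.mul_im, zero_add, Complex.ofReal_one, Complex.ofReal_neg, smul_eq_mul] at h
  have hconj : ∫ y in (0 : ℝ)..Y, (starRingEnd ℂ) (poissonIntegrand a x (1 + y * Complex.I)) =
      (starRingEnd ℂ) (∫ y in (0 : ℝ)..Y, poissonIntegrand a x (1 + y * Complex.I)) := by
    simp only [intervalIntegral.integral_of_le hY, integral_conj]
  simp only [poissonIntegrand_neg_one_add, hconj] at h
  simp only [poissonIntegrand_one_add, intervalIntegral.integral_const_mul] at h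
  rw [integral_cos_eq_re a x ha]
  have hre := congrArg Complex.re h
  simp only [Complex.add_re, Complex.sub_re, Complex.I_mul_re, Complex.zero_re,
    Complex.conj_im] at hre
  linarith

theorem tendsto_poisson_top {a x : ℝ} (ha : 0 < a) (hx : 0 < x) :
    Tendsto (fun Y : ℝ => ∫ t in (-1 : ℝ)..1, poissonIntegrand a x (t + Y * Complex.I))
      atTop (𝓝 0) := by
  have h := (tendsto_add_two_rpow_mul_exp_neg a hx).mul_const 2
  rw [zero_mul] at h
  refine squeeze_zero_norm' ?_ h
  filter_upwards [eventually_ge_atTop 0] with Y hY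
  have := intervalIntegral.norm_integral_le_of_norm_le_const (a := -1) (b := 1)
    (f := fun t : ℝ => poissonIntegrand a x (t + Y * Complex.I))
    (C := ((Y + 2) ^ 2) ^ a * Real.exp (-x * Y)) fun t ht => ?_
  · convert this using 2; norm_num
  · rw [uIoc_of_le (by norm_num)] at ht
    rw [poissonIntegrand, norm_mul, Complex.norm_cpow_real, Complex.norm_exp]
    have h1 : (Complex.I * x * (t + Y * Complex.I)).re = -x * Y := by simp
    rw [h1]
    gcongr
    have ht' : |t| ≤ 1 := abs_le.2 ⟨ht.1.le, ht.2⟩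
    have h2 : ‖(t + Y * Complex.I : ℂ)‖ ≤ 1 + Y := by
      refine (norm_add_le _ _).trans ?_
      simpa [abs_of_nonneg hY] using ht'
    calc ‖1 - (t + Y * Complex.I : ℂ) ^ 2‖ ≤ ‖(1 : ℂ)‖ + ‖(t + Y * Complex.I : ℂ) ^ 2‖ :=
          norm_sub_le _ _
      _ ≤ 1 + (1 + Y) ^ 2 := by rw [norm_one, norm_pow]; gcongr
      _ ≤ (Y + 2) ^ 2 := by nlinarith

theorem integral_cos_eq_hankel {a x : ℝ} (ha : 0 < a) (hx : 0 < x) :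
    ∫ t in (-1 : ℝ)..1, Real.cos (x * t) * (1 - t ^ 2) ^ a =
      2 * (Complex.exp (Complex.I * x) * ∫ y in Ioi (0 : ℝ), hankelIntegrand a x y).im := by
  have h1 := intervalIntegral_tendsto_integral_Ioi 0 (integrableOn_hankelIntegrand ha hx)
    tendsto_id
  have h2 := ((Complex.continuous_im.tendsto _).comp
    (h1.const_mul (Complex.exp (Complex.I * x)))).const_mul 2
  have h3 := h2.add ((Complex.continuous_re.tendsto _).comp (tendsto_poisson_top ha hx))
  rw [Complex.zero_re, add_zero] at h3
  refine tendsto_nhds_unique (tendsto_const_nhds.congr' ?_) h3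
  filter_upwards [eventually_ge_atTop 0] with Y hY
  exact poisson_contour ha hY

/-! ### Asymptotics of J_ν at infinity -/

theorem hankelIntegrand_scale {a x u : ℝ} (hx : 0 < x) (hu : 0 < u) :
    ((x ^ a : ℝ) : ℂ) * hankelIntegrand a x (x⁻¹ * u) =
      ((x⁻¹ * u ^ 2 : ℝ) - 2 * u * Complex.I : ℂ) ^ (a : ℂ) * (Real.exp (-u) : ℝ) := by
  have hw : (((x⁻¹ * u) ^ 2 : ℝ) - 2 * (x⁻¹ * u : ℝ) * Complex.I : ℂ) ≠ 0 := by
    intro h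
    have := congrArg Complex.im h
    simp [-Complex.ofReal_mul, -Complex.ofReal_pow] at this
    exact this.elim hx.ne' hu.ne'
  have h : ((x⁻¹ * u ^ 2 : ℝ) - 2 * u * Complex.I : ℂ) =
      (x : ℂ) * (((x⁻¹ * u) ^ 2 : ℝ) - 2 * (x⁻¹ * u : ℝ) * Complex.I) := by
    have : (x : ℂ) ≠ 0 := by exact_mod_cast hx.ne'
    push_cast
    field_simp
  have hx' : (x : ℂ) ≠ 0 := by exact_mod_cast hx.ne'
  rw [h, Complex.cpow_def_of_ne_zero (mul_ne_zero hx' hw), Complex.log_ofReal_mul hx hw, add_mul,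
    Complex.exp_add, ← Complex.cpow_def_of_ne_zero hw, Complex.ofReal_cpow hx.le,
    Complex.cpow_def_of_ne_zero hx', Complex.ofReal_log hx.le, hankelIntegrand,
    show -x * (x⁻¹ * u) = -u by field_simp]
  ring

/-- Substitute y = u/x and apply dominated convergence; one majorant serves all x ≥ 1. -/
theorem tendsto_hankel {a : ℝ} (ha : 0 < a) :
    Tendsto (fun x : ℝ => ((x ^ (a + 1) : ℝ) : ℂ) * ∫ y in Ioi (0 : ℝ), hankelIntegrand a x y)
      atTop (𝓝 (∫ u in Ioi (0 : ℝ), (-(2 * u * Complex.I) : ℂ) ^ (a : ℂ) * (Real.exp (-u) : ℝ))) := by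
  have hlim : Tendsto (fun x : ℝ => ∫ u in Ioi (0 : ℝ),
      ((x⁻¹ * u ^ 2 : ℝ) - 2 * u * Complex.I : ℂ) ^ (a : ℂ) * (Real.exp (-u) : ℝ)) atTop
      (𝓝 (∫ u in Ioi (0 : ℝ), (-(2 * u * Complex.I) : ℂ) ^ (a : ℂ) * (Real.exp (-u) : ℝ))) := by
    refine tendsto_integral_filter_of_dominated_convergence
      (fun u : ℝ => ((u + 2) ^ 2) ^ a * Real.exp (-1 * u)) ?_ ?_
      (integrableOn_add_two_rpow_mul_exp_neg ha one_pos) ?_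
    · filter_upwards [eventually_gt_atTop 0] with x hx
      have := continuous_cpow_sub_mul_I ha (inv_nonneg.2 hx.le)
      exact Continuous.aestronglyMeasurable (by fun_prop)
    · filter_upwards [eventually_ge_atTop 1] with x hx
      filter_upwards [ae_restrict_mem measurableSet_Ioi] with u hu
      rw [norm_mul, Complex.norm_real, Real.norm_of_nonneg (Real.exp_pos _).le, neg_one_mul]
      gcongr
      exact norm_cpow_sub_mul_I_le ha (by positivity) (inv_le_one_of_one_le₀ hx) (le_of_lt hu)
    · filter_upwards [ae_restrict_mem measurableSet_Ioi] with u hu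
      refine Tendsto.mul_const _ ?_
      have h := Complex.continuousAt_cpow_const_of_re_pos
        (z := -(2 * u * Complex.I : ℂ)) (w := (a : ℂ)) (Or.inl (by simp)) (by simpa)
      refine h.tendsto.comp ?_
      have h0 : Tendsto (fun x : ℝ => x⁻¹ * u ^ 2) atTop (𝓝 (0 * u ^ 2)) :=
        tendsto_inv_atTop_zero.mul_const _
      have h1 := ((Complex.continuous_ofReal.tendsto _).comp h0).sub_const (2 * u * Complex.I)
      simpa only [zero_mul, Complex.ofReal_zero, zero_sub, Function.comp_def] using h1
  refine hlim.congr' ?_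
  filter_upwards [eventually_gt_atTop 0] with x hx
  have h1 := integral_comp_mul_left_Ioi (hankelIntegrand a x) 0 (inv_pos.2 hx)
  rw [mul_zero, inv_inv] at h1
  have h2 : ((x ^ (a + 1) : ℝ) : ℂ) * ∫ y in Ioi (0 : ℝ), hankelIntegrand a x y =
      ((x ^ a : ℝ) : ℂ) * (x • ∫ y in Ioi (0 : ℝ), hankelIntegrand a x y) := by
    rw [Real.rpow_add_one hx.ne', Complex.real_smul]; push_cast; ring
  rw [h2, ← h1, ← integral_const_mul]
  refine setIntegral_congr_fun measurableSet_Ioi fun u hu => ?_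
  exact (hankelIntegrand_scale hx hu).symm

theorem hankel_limit_eq {a : ℝ} (ha : 0 < a) : ∃ c > 0,
    ∫ u in Ioi (0 : ℝ), (-(2 * u * Complex.I) : ℂ) ^ (a : ℂ) * (Real.exp (-u) : ℝ) =
      (c : ℝ) * Complex.exp (((-(Real.pi * a / 2) : ℝ) : ℂ) * Complex.I) := by
  refine ⟨2 ^ a * Real.Gamma (a + 1),
    mul_pos (by positivity) (Real.Gamma_pos_of_pos (by positivity)), ?_⟩
  rw [Real.Gamma_eq_integral (by positivity), ← integral_const_mul,
    ← integral_complex_ofReal, ← integral_mul_const]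
  refine setIntegral_congr_fun measurableSet_Ioi fun u hu => ?_
  have hu' : (0 : ℝ) < u := hu
  have hI : (-Complex.I) ≠ 0 := by simp
  have h2u : (0 : ℝ) < 2 * u := by positivity
  have h2u' : ((2 * u : ℝ) : ℂ) ≠ 0 := by exact_mod_cast h2u.ne'
  have h1 : (-(2 * u * Complex.I) : ℂ) = ((2 * u : ℝ) : ℂ) * (-Complex.I) := by push_cast; ring
  have h3 : (-(2 * u * Complex.I) : ℂ) ^ (a : ℂ) =
      (((2 * u) ^ a : ℝ) : ℂ) * Complex.exp (((-(Real.pi * a / 2) : ℝ) : ℂ) * Complex.I) := by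
    rw [h1, Complex.cpow_def_of_ne_zero (mul_ne_zero h2u' hI), Complex.log_ofReal_mul h2u hI,
      add_mul, Complex.exp_add, Complex.ofReal_cpow h2u.le, Complex.cpow_def_of_ne_zero h2u',
      Complex.ofReal_log h2u.le, Complex.log_neg_I]
    congr 2
    push_cast; ring
  simp only [h3, add_sub_cancel_right, Real.mul_rpow zero_le_two hu'.le]
  push_cast
  ring

/-- `√x J_ν(x) = A cos (x - νπ/2 - π/4) + o(1)` for some `A > 0`. -/
def HasBesselAsymptotics (ν : ℝ) : Prop :=
  ∃ A > 0, Tendsto (fun x => Real.sqrt x * besselJ ν x -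
    A * Real.cos (x - (ν * Real.pi / 2 + Real.pi / 4))) atTop (𝓝 0)

theorem hasBesselAsymptotics_of_half_lt {ν : ℝ} (hν : 1 / 2 < ν) : HasBesselAsymptotics ν := by
  obtain ⟨a, rfl⟩ : ∃ a, ν = a + 1 / 2 := ⟨ν - 1 / 2, by ring⟩
  have ha : 0 < a := by linarith
  obtain ⟨c, hc, hL⟩ := hankel_limit_eq ha
  have hlim := tendsto_hankel ha
  rw [hL] at hlim
  set L : ℂ := (c : ℝ) * Complex.exp (((-(Real.pi * a / 2) : ℝ) : ℂ) * Complex.I) with hLdef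
  set B : ℝ := jacobiMoment a 0 * Real.Gamma (a + 3 / 2) with hB
  have hBpos : 0 < B := mul_pos (jacobiMoment_zero_pos ha) (Real.Gamma_pos_of_pos (by positivity))
  set M : ℝ := 2 / (B * 2 ^ (a + 1 / 2)) with hM
  have hMpos : 0 < M := by positivity
  refine ⟨M * c, by positivity, ?_⟩
  have hlim0 := (tendsto_iff_norm_sub_tendsto_zero.1 hlim).const_mul M
  rw [mul_zero] at hlim0
  refine squeeze_zero_norm' ?_ hlim0
  filter_upwards [eventually_gt_atTop 0] with x hx
  set H : ℂ := ∫ y in Ioi (0 : ℝ), hankelIntegrand a x y with hH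
  have hJ : Real.sqrt x * besselJ (a + 1 / 2) x =
      M * (Complex.exp (Complex.I * x) * (((x ^ (a + 1) : ℝ) : ℂ) * H)).im := by
    have h1 := integral_cos_mul_jacobiWeight ha x
    rw [integral_cos_eq_hankel ha hx, ← hH, ← hB] at h1
    have h2 : (Complex.exp (Complex.I * x) * (((x ^ (a + 1) : ℝ) : ℂ) * H)).im =
        x ^ (a + 1) * (Complex.exp (Complex.I * x) * H).im := by
      rw [mul_left_comm, Complex.im_ofReal_mul]
    have h3 : besselSeries (a + 1 / 2) ((x / 2) ^ 2) =
        2 * (Complex.exp (Complex.I * x) * H).im / B := by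
      rw [h1]; field_simp
    rw [h2, besselJ_eq, h3, hM, Real.div_rpow hx.le zero_le_two, Real.sqrt_eq_rpow,
      show a + 1 = 1 / 2 + (a + 1 / 2) by ring, Real.rpow_add hx (1 / 2) (a + 1 / 2)]
    have hr : (2 : ℝ) ^ (a + 1 / 2) ≠ 0 := by positivity
    generalize (2 : ℝ) ^ (a + 1 / 2) = r at *
    generalize x ^ (a + 1 / 2) = q at *
    generalize x ^ (1 / 2 : ℝ) = p at *
    field_simp
  have hcos : M * c * Real.cos (x - ((a + 1 / 2) * Real.pi / 2 + Real.pi / 4)) =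
      M * (Complex.exp (Complex.I * x) * L).im := by
    have h1 : Complex.exp (Complex.I * x) * L =
        (c : ℝ) * Complex.exp (((x - Real.pi * a / 2 : ℝ) : ℂ) * Complex.I) := by
      rw [hLdef, mul_left_comm, ← Complex.exp_add]
      congr 2
      push_cast; ring
    rw [h1, Complex.im_ofReal_mul, Complex.exp_ofReal_mul_I_im,
      show x - ((a + 1 / 2) * Real.pi / 2 + Real.pi / 4) =
        (x - Real.pi * a / 2) - Real.pi / 2 by ring, Real.cos_sub_pi_div_two, mul_assoc]
  rw [hJ, hcos, ← mul_sub, ← Complex.sub_im, ← mul_sub, norm_mul, Real.norm_of_nonneg hMpos.le]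
  gcongr
  refine (Complex.abs_im_le_norm _).trans ?_
  rw [norm_mul, mul_comm Complex.I, Complex.norm_exp_ofReal_mul_I, one_mul]

/-- The recurrence gives J_ν = 2(ν + 1)J_{ν+1}/x - J_{ν+2}. The first term is negligible, and the
phase of the second is shifted by π, which cancels the minus sign. -/
theorem hasBesselAsymptotics {ν : ℝ} (hν : 0 ≤ ν) : HasBesselAsymptotics ν := by
  obtain ⟨A₁, -, h1⟩ := hasBesselAsymptotics_of_half_lt (ν := ν + 1) (by linarith)
  obtain ⟨A, hA, h2⟩ := hasBesselAsymptotics_of_half_lt (ν := ν + 2) (by linarith)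
  refine ⟨A, hA, ?_⟩
  have h3 : Tendsto (fun x => 2 * (ν + 1) / x * (Real.sqrt x * besselJ (ν + 1) x)) atTop
      (𝓝 0) := by
    have h0 : Tendsto (fun x : ℝ => 2 * (ν + 1) / x) atTop (𝓝 0) :=
      tendsto_id.const_div_atTop _
    have h4 : Tendsto (fun x => 2 * (ν + 1) / x *
        (A₁ * Real.cos (x - ((ν + 1) * Real.pi / 2 + Real.pi / 4)))) atTop (𝓝 0) := by
      have h7 : Tendsto (fun x : ℝ => ‖2 * (ν + 1) / x‖ * ‖A₁‖) atTop (𝓝 0) := by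
        simpa using h0.norm.mul_const ‖A₁‖
      refine squeeze_zero_norm (fun x => ?_) h7
      rw [norm_mul, norm_mul]
      refine mul_le_mul_of_nonneg_left ?_ (norm_nonneg _)
      exact mul_le_of_le_one_right (norm_nonneg _) (Real.abs_cos_le_one _)
    have h5 := (h0.mul h1).add h4
    rw [mul_zero, add_zero] at h5
    exact h5.congr fun x => by ring
  have h6 := h3.sub h2
  rw [sub_zero] at h6
  refine h6.congr' ?_
  filter_upwards [eventually_gt_atTop 0] with x hx
  have hr := besselJ_recurrence hν hx
  have hcos : Real.cos (x - ((ν + 2) * Real.pi / 2 + Real.pi / 4)) =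
      -Real.cos (x - (ν * Real.pi / 2 + Real.pi / 4)) := by
    rw [← Real.cos_sub_pi]; ring_nf
  rw [hcos]
  have hJ : besselJ ν x = 2 * (ν + 1) / x * besselJ (ν + 1) x - besselJ (ν + 2) x := by
    field_simp; linarith
  rw [hJ]
  ring

/-! ### The case ν = 1/2: zeros of the sine -/

theorem besselCoeff_half (m : ℕ) : besselCoeff (1 / 2) m / 4 ^ m =
    besselCoeff (1 / 2) 0 * ((-1) ^ m / (Nat.factorial (2 * m + 1) : ℝ)) := by
  induction m with
  | zero => simp
  | succ m ih =>
    rw [besselCoeff_succ (by norm_num), show 2 * (m + 1) + 1 = 2 * m + 1 + 1 + 1 by ring,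
      Nat.factorial_succ, Nat.factorial_succ]
    have hf := Nat.factorial_ne_zero (2 * m + 1)
    have hm : (m : ℝ) + 1 / 2 + 1 ≠ 0 := by positivity
    push_cast
    calc _ = (besselCoeff (1 / 2) m / 4 ^ m) * (-1 / ((2 * m + 1 + 1) * (2 * m + 1 + 1 + 1))) := by
          field_simp; ring
      _ = _ := by rw [ih]; field_simp; ring

theorem mul_besselSeries_half (x : ℝ) :
    x * besselSeries (1 / 2) ((x / 2) ^ 2) = besselCoeff (1 / 2) 0 * Real.sin x := by
  refine ((hasSum_besselSeries (ν := 1 / 2) (by norm_num) ((x / 2) ^ 2)).mul_left x).unique ?_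
  refine ((Real.hasSum_sin x).mul_left (besselCoeff (1 / 2) 0)).congr_fun fun m => ?_
  have h := besselCoeff_half m
  rw [div_pow, div_pow, ← pow_mul, pow_succ x, show (2 : ℝ) ^ 2 = 4 by norm_num]
  linear_combination (x * x ^ (2 * m)) * h

theorem besselZeros_half : besselZeros (1 / 2) = {x | 0 < x ∧ Real.sin x = 0} := by
  ext x
  refine and_congr_right fun hx => ?_
  have h := mul_besselSeries_half x
  have hc := besselCoeff_ne_zero (ν := 1 / 2) (by norm_num) 0
  have hp : (x / 2) ^ (1 / 2 : ℝ) ≠ 0 := by positivity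
  rw [besselJ_eq, mul_eq_zero, or_iff_right hp]
  constructor
  · intro h0
    rw [h0, mul_zero] at h
    exact (mul_eq_zero.1 h.symm).resolve_left hc
  · intro h0
    rw [h0, mul_zero] at h
    exact (mul_eq_zero.1 h).resolve_left hx.ne'

theorem besselCount_half {k : ℕ} {x : ℝ} (h1 : k * Real.pi ≤ x) (h2 : x < (k + 1) * Real.pi) :
    besselCount (1 / 2) x = k := by
  have hpi := Real.pi_pos
  have he : besselZeros (1 / 2) ∩ Iic x =
      (fun n : ℕ => ((n : ℝ) + 1) * Real.pi) '' (Finset.range k : Set ℕ) := by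
    rw [besselZeros_half]
    ext y
    simp only [mem_inter_iff, mem_ofPred_eq, mem_Iic, mem_image, Finset.coe_range, mem_Iio]
    constructor
    · rintro ⟨⟨hy, hs⟩, hyx⟩
      obtain ⟨n, rfl⟩ := Real.sin_eq_zero_iff.1 hs
      have hn : 0 < n := by
        have := pos_of_mul_pos_left hy hpi.le
        exact_mod_cast this
      have hnk : n < k + 1 := by
        have : (n : ℝ) < (k + 1 : ℤ) := by
          push_cast
          exact lt_of_mul_lt_mul_right (hyx.trans_lt h2) hpi.le
        exact_mod_cast this
      obtain ⟨j, rfl⟩ : ∃ j : ℕ, n = j + 1 := ⟨(n - 1).toNat, by omega⟩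
      exact ⟨j, by omega, by push_cast; ring⟩
    · rintro ⟨n, hn, rfl⟩
      refine ⟨⟨by positivity, ?_⟩, le_trans ?_ h1⟩
      · exact_mod_cast Real.sin_nat_mul_pi (n + 1)
      · have : ((n + 1 : ℕ) : ℝ) ≤ k := by exact_mod_cast hn
        push_cast at this
        gcongr
  rw [besselCount, he, ncard_image_of_injective _ fun a b hab => ?_, ncard_coe_finset,
    Finset.card_range]
  have := mul_right_cancel₀ hpi.ne' hab
  exact_mod_cast add_right_cancel this

/-! ### Exact zero counts far out -/

/-- The phase shift in `J_ν(x) ≈ √(2/(πx)) cos (x - α_ν)`. -/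
noncomputable def besselShift (ν : ℝ) : ℝ := ν * Real.pi / 2 + Real.pi / 4

theorem besselShift_succ (ν : ℝ) : besselShift (ν + 1) = besselShift ν + Real.pi / 2 := by
  unfold besselShift; ring

/-- On the window the absolute value of the cosine is at least sin ε, which eventually dominates the
error. -/
theorem eventually_sign_of_tendsto_cos {g : ℝ → ℝ} {A α ε : ℝ} (hA : 0 < A) (hε : 0 < ε)
    (hg : Tendsto (fun x => g x - A * Real.cos (x - α)) atTop (𝓝 0)) :
    ∀ᶠ k : ℕ in atTop, ∀ x, |x - α - k * Real.pi| ≤ Real.pi / 2 - ε → 0 < (-1) ^ k * g x := by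
  rcases lt_or_ge (Real.pi / 2) ε with h | h
  · exact Eventually.of_forall fun k x hx => by linarith [abs_nonneg (x - α - k * Real.pi)]
  have hs : 0 < Real.sin ε := Real.sin_pos_of_pos_of_lt_pi hε (by linarith [Real.pi_pos])
  obtain ⟨X, hX⟩ := eventually_atTop.1
    ((tendsto_iff_norm_sub_tendsto_zero.1 hg).eventually_lt_const (mul_pos hA hs))
  have hk : Tendsto (fun k : ℕ => (k : ℝ) * Real.pi) atTop atTop :=
    tendsto_natCast_atTop_atTop.atTop_mul_const Real.pi_pos
  filter_upwards [hk.eventually_ge_atTop (X - α + Real.pi / 2)] with k hk x hx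
  have hx' := abs_le.1 hx
  have h1 := hX x (by linarith)
  rw [sub_zero, Real.norm_eq_abs] at h1
  have hcos : Real.cos (x - α) = (-1) ^ k * Real.cos (x - α - k * Real.pi) := by
    rw [Real.cos_sub_nat_mul_pi, ← mul_assoc, ← mul_pow]; norm_num
  have h2 : Real.sin ε ≤ Real.cos (x - α - k * Real.pi) := by
    rw [← Real.cos_pi_div_two_sub, ← Real.cos_abs (x - α - k * Real.pi)]
    exact Real.cos_le_cos_of_nonneg_of_le_pi (abs_nonneg _) (by linarith [Real.pi_pos]) hx
  have h3 : |(-1) ^ k * g x - A * Real.cos (x - α - k * Real.pi)| < A * Real.sin ε := by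
    have : (-1) ^ k * g x - A * Real.cos (x - α - k * Real.pi) =
        (-1) ^ k * (g x - A * Real.cos (x - α)) := by
      have h1 : ((-1 : ℝ) ^ k) * (-1) ^ k = 1 := by rw [← mul_pow]; norm_num
      rw [hcos]
      linear_combination (A * Real.cos (x - α - k * Real.pi)) * h1
    rwa [this, abs_mul, abs_pow, abs_neg, abs_one, one_pow, one_mul]
  have h4 := (abs_lt.1 h3).1
  have h5 := mul_le_mul_of_nonneg_left h2 hA.le
  linarith

theorem eventually_besselJ_ne_zero {ν ε : ℝ} (hν : 0 ≤ ν) (hε : 0 < ε) :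
    ∀ᶠ k : ℕ in atTop, ∀ x, |x - besselShift ν - k * Real.pi| ≤ Real.pi / 2 - ε →
      besselJ ν x ≠ 0 := by
  obtain ⟨A, hA, h⟩ := hasBesselAsymptotics hν
  filter_upwards [eventually_sign_of_tendsto_cos hA hε h] with k hk x hx h0
  have := hk x hx
  rw [h0, mul_zero, mul_zero] at this
  exact this.false

theorem eventually_besselCount_eq {ν ε : ℝ} (hν : 0 ≤ ν) (hε : 0 < ε) :
    ∀ᶠ k : ℕ in atTop, ∀ x y, |x - besselShift ν - k * Real.pi| ≤ Real.pi / 2 - ε →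
      |y - besselShift ν - k * Real.pi| ≤ Real.pi / 2 - ε →
      besselCount ν x = besselCount ν y := by
  filter_upwards [eventually_besselJ_ne_zero hν hε] with k hk x y hx hy
  have main : ∀ {x y : ℝ}, |x - besselShift ν - k * Real.pi| ≤ Real.pi / 2 - ε →
      |y - besselShift ν - k * Real.pi| ≤ Real.pi / 2 - ε → x ≤ y →
      besselCount ν x = besselCount ν y := fun {x y} hx hy hxy => by
    refine besselCount_congr hxy fun z hz => hk z ?_
    rw [abs_le] at hx hy ⊢
    exact ⟨by linarith [hz.1], by linarith [hz.2]⟩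
  rcases le_total x y with h | h
  · exact main hx hy h
  · exact (main hy hx h).symm

/-- For large `k` the function `J_ν` has exactly `k` zeros up to every point of the interval where
`x - α_ν` is within `π/2 - ε` of `kπ`. -/
def BesselCountAsymptotics (ν : ℝ) : Prop :=
  ∀ ε > 0, ∀ᶠ k : ℕ in atTop, ∀ x, |x - besselShift ν - k * Real.pi| ≤ Real.pi / 2 - ε →
    besselCount ν x = k

/-- The count is eventually constant on each window, so an upper bound at one point of it and a
lower bound at another determine it. -/
theorem besselCountAsymptotics_of_bounds {ν c d : ℝ} (hν : 0 ≤ ν) (hc : |c| < Real.pi / 2)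
    (hd : |d| < Real.pi / 2)
    (h1 : ∀ᶠ k : ℕ in atTop, besselCount ν (besselShift ν + k * Real.pi + c) ≤ k)
    (h2 : ∀ᶠ k : ℕ in atTop, k ≤ besselCount ν (besselShift ν + k * Real.pi + d)) :
    BesselCountAsymptotics ν := by
  intro ε hε
  set δ := min ε (min (Real.pi / 2 - |c|) (Real.pi / 2 - |d|)) with hδ
  have hδ0 : 0 < δ := lt_min hε (lt_min (by linarith) (by linarith))
  have hδc : δ ≤ Real.pi / 2 - |c| := (min_le_right _ _).trans (min_le_left _ _)
  have hδd : δ ≤ Real.pi / 2 - |d| := (min_le_right _ _).trans (min_le_right _ _)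
  filter_upwards [h1, h2, eventually_besselCount_eq hν hδ0] with k h1 h2 h x hx
  have hx' := hx.trans (sub_le_sub_left (min_le_left _ _ : δ ≤ ε) _)
  have e1 := h x (besselShift ν + k * Real.pi + c) hx' (by
    rw [show besselShift ν + k * Real.pi + c - besselShift ν - k * Real.pi = c by ring]; linarith)
  have e2 := h x (besselShift ν + k * Real.pi + d) hx' (by
    rw [show besselShift ν + k * Real.pi + d - besselShift ν - k * Real.pi = d by ring]; linarith)
  omega

theorem BesselCountAsymptotics.eventually_eq {ν c : ℝ} (h : BesselCountAsymptotics ν)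
    (hc : |c| < Real.pi / 2) :
    ∀ᶠ k : ℕ in atTop, besselCount ν (besselShift ν + k * Real.pi + c) = k := by
  filter_upwards [h (Real.pi / 2 - |c|) (by linarith)] with k hk
  refine hk _ ?_
  rw [show besselShift ν + k * Real.pi + c - besselShift ν - k * Real.pi = c by ring]
  linarith

theorem besselCountAsymptotics_half : BesselCountAsymptotics (1 / 2) := by
  intro ε hε
  refine Eventually.of_forall fun k x hx => ?_
  rw [besselShift, abs_le] at hx
  exact besselCount_half (by linarith [hx.1]) (by linarith [hx.2])

theorem abs_pi_div_four_lt : |Real.pi / 4| < Real.pi / 2 := by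
  rw [abs_of_pos (by positivity)]; linarith [Real.pi_pos]

theorem abs_neg_pi_div_four_lt : |-(Real.pi / 4)| < Real.pi / 2 := by
  rw [abs_neg]; exact abs_pi_div_four_lt

/-- The windows for ν + 1 are shifted by π/2. The left part of the kth one lies in the kth window
for ν, where monotonicity bounds the count by k; the right part lies in the next one, where the
count k + 1 drops by at most 1. -/
theorem BesselCountAsymptotics.succ {ν : ℝ} (hν : 0 ≤ ν) (h : BesselCountAsymptotics ν) :
    BesselCountAsymptotics (ν + 1) := by
  refine besselCountAsymptotics_of_bounds (by positivity) abs_neg_pi_div_four_lt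
    abs_pi_div_four_lt ?_ ?_
  · filter_upwards [h.eventually_eq abs_pi_div_four_lt] with k hk
    rw [besselShift_succ, show besselShift ν + Real.pi / 2 + k * Real.pi + -(Real.pi / 4) =
      besselShift ν + k * Real.pi + Real.pi / 4 by ring]
    exact (besselCount_anti_index hν (by linarith) _).trans hk.le
  · filter_upwards [(tendsto_add_atTop_nat 1).eventually
      (h.eventually_eq abs_neg_pi_div_four_lt)] with k hk
    rw [besselShift_succ, show besselShift ν + Real.pi / 2 + k * Real.pi + Real.pi / 4 =
      besselShift ν + (k + 1 : ℕ) * Real.pi + -(Real.pi / 4) by push_cast; ring]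
    have := besselCount_le_succ hν (besselShift ν + (k + 1 : ℕ) * Real.pi + -(Real.pi / 4))
    omega

theorem besselCountAsymptotics_half_add (m : ℕ) : BesselCountAsymptotics (m + 1 / 2) := by
  induction m with
  | zero => simpa using besselCountAsymptotics_half
  | succ m ih =>
    have := ih.succ (by positivity)
    push_cast
    convert this using 1
    ring

/-- By monotonicity the count is squeezed between those of two consecutive half-integer indices; at
the centre of a window for ν both are known, since the shifts differ by less than π/2. -/
theorem besselCountAsymptotics_of_half_le {ν : ℝ} (hν : 1 / 2 ≤ ν) :
    BesselCountAsymptotics ν := by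
  have hpi := Real.pi_pos
  obtain ⟨m, hm1, hm2⟩ : ∃ m : ℕ, (m : ℝ) + 1 / 2 ≤ ν ∧ ν < m + 1 / 2 + 1 :=
    ⟨⌊ν - 1 / 2⌋₊, by linarith [Nat.floor_le (show 0 ≤ ν - 1 / 2 by linarith)],
      by linarith [Nat.lt_floor_add_one (ν - 1 / 2)]⟩
  have h := besselCountAsymptotics_half_add m
  rcases hm1.eq_or_lt with rfl | hlt
  · exact h
  set μ : ℝ := (m : ℝ) + 1 / 2 with hμ
  have hμ0 : 0 ≤ μ := by positivity
  have h0 : |(0 : ℝ)| < Real.pi / 2 := by rw [abs_zero]; positivity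
  refine besselCountAsymptotics_of_bounds (by linarith) h0 h0 ?_ ?_
  · have hc : |(ν - μ) * Real.pi / 2| < Real.pi / 2 := by
      rw [abs_of_nonneg (by have := sub_nonneg.2 hm1; positivity)]
      nlinarith
    filter_upwards [h.eventually_eq hc] with k hk
    rw [show besselShift ν + k * Real.pi + 0 = besselShift μ + k * Real.pi +
      (ν - μ) * Real.pi / 2 by unfold besselShift; ring]
    exact (besselCount_anti_index hμ0 hlt _).trans hk.le
  · have hc : |(ν - (μ + 1)) * Real.pi / 2| < Real.pi / 2 := by
      rw [abs_lt]; constructor <;> nlinarith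
    filter_upwards [(h.succ hμ0).eventually_eq hc] with k hk
    rw [show besselShift ν + k * Real.pi + 0 = besselShift (μ + 1) + k * Real.pi +
      (ν - (μ + 1)) * Real.pi / 2 by unfold besselShift; ring]
    exact hk.symm.le.trans (besselCount_anti_index (by linarith) hm2 _)

theorem besselCountAsymptotics {ν : ℝ} (hν : 0 ≤ ν) : BesselCountAsymptotics ν := by
  have hpi := Real.pi_pos
  rcases le_or_gt (1 / 2) ν with h | h
  · exact besselCountAsymptotics_of_half_le h
  have h0 : |(0 : ℝ)| < Real.pi / 2 := by rw [abs_zero]; positivity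
  -- For ν < 1/2 the upper bound comes from index ν + 1 by interlacing, the lower one from index 1/2
  -- by monotonicity.
  refine besselCountAsymptotics_of_bounds hν abs_neg_pi_div_four_lt h0 ?_ ?_
  · have h1 := (besselCountAsymptotics_of_half_le (ν := ν + 1) (by linarith)).eventually_eq
      abs_pi_div_four_lt
    rw [← map_add_atTop_eq_nat 1, eventually_map]
    filter_upwards [h1] with k hk
    have := besselCount_le_succ hν (besselShift ν + (k + 1 : ℕ) * Real.pi + -(Real.pi / 4))
    rw [show besselShift ν + (k + 1 : ℕ) * Real.pi + -(Real.pi / 4) =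
      besselShift (ν + 1) + k * Real.pi + Real.pi / 4 by
        rw [besselShift_succ]; push_cast; ring] at this ⊢
    omega
  · have hc : |(ν - 1 / 2) * Real.pi / 2| < Real.pi / 2 := by
      rw [abs_lt]; constructor <;> nlinarith
    filter_upwards [besselCountAsymptotics_half.eventually_eq hc] with k hk
    rw [show besselShift ν + k * Real.pi + 0 = besselShift (1 / 2) + k * Real.pi +
      (ν - 1 / 2) * Real.pi / 2 by unfold besselShift; ring]
    exact hk.symm.le.trans (besselCount_anti_index hν h _)

/-! ### The two phase bounds, carried back from infinity -/

theorem besselPhase_le {ν x : ℝ} (hν : 0 ≤ ν) (hx : 0 ≤ x) : besselPhase ν x ≤ x := by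
  have h1 : Real.sqrt (x ^ 2 - ν ^ 2) ≤ x := Real.sqrt_le_iff.2 ⟨hx, by nlinarith [sq_nonneg ν]⟩
  have h2 := mul_nonneg hν (Real.arccos_nonneg (ν / x))
  unfold besselPhase
  linarith

theorem eventually_abs_besselPhase_sub_lt {ν δ s : ℝ} (hν : 0 ≤ ν) (hδ : 0 < δ) :
    ∀ᶠ m : ℕ in atTop, ∀ b, 0 ≤ b → besselPhase ν b = s + m * Real.pi →
      |besselPhase ν b - (b - ν * Real.pi / 2)| < δ := by
  obtain ⟨X, hX⟩ := eventually_atTop.1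
    ((tendsto_iff_norm_sub_tendsto_zero.1 (tendsto_besselPhase_sub hν)).eventually_lt_const hδ)
  have hk : Tendsto (fun k : ℕ => (k : ℝ) * Real.pi) atTop atTop :=
    tendsto_natCast_atTop_atTop.atTop_mul_const Real.pi_pos
  filter_upwards [hk.eventually_ge_atTop (X - s)] with m hm b hb hs
  have := hX b (by linarith [besselPhase_le hν hb])
  rwa [sub_zero, Real.norm_eq_abs] at this

theorem pi_mul_besselCount_le {ν x : ℝ} (hν : 0 ≤ ν) (hx : ν < x) :
    Real.pi * besselCount ν x ≤ besselPhase ν x + Real.pi / 4 := by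
  by_contra! hlt
  set N := besselCount ν x
  set δ := Real.pi * N - (besselPhase ν x + Real.pi / 4) with hδ
  have hδ0 : 0 < δ := by linarith
  have hpi := Real.pi_pos
  have hmin : min (δ / 2) (Real.pi / 4) ≤ δ / 2 := min_le_left _ _
  have hmin2 : min (δ / 2) (Real.pi / 4) ≤ Real.pi / 4 := min_le_right _ _
  set ε := min (δ / 2) (Real.pi / 4) with hε
  have hε0 : 0 < ε := lt_min (by linarith) (by linarith)
  obtain ⟨K, hK⟩ := eventually_atTop.1 (besselCountAsymptotics hν ε hε0)
  obtain ⟨m, hm, hmK⟩ := ((eventually_abs_besselPhase_sub_lt (s := besselPhase ν x) hν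
    (half_pos hδ0)).and (eventually_ge_atTop (K + 1))).exists
  obtain ⟨b, hxb, hs, hN⟩ := exists_besselCount_add_le hν hx m
  have h1 := abs_lt.1 (hm b (by linarith) hs)
  -- The excess δ puts b at or before α + jπ + π/2 - ε, the end of window j, where the count is only
  -- j = N + m - 1.
  obtain ⟨j, hj⟩ : ∃ j, N + m = j + 1 := ⟨N + m - 1, by omega⟩
  have hj' : (N : ℝ) + m = j + 1 := by exact_mod_cast hj
  have h2 := hK j (by omega) (besselShift ν + j * Real.pi + (Real.pi / 2 - ε)) (by
    rw [show besselShift ν + j * Real.pi + (Real.pi / 2 - ε) - besselShift ν - j * Real.pi =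
      Real.pi / 2 - ε by ring, abs_of_nonneg (by linarith)])
  have h3 : b ≤ besselShift ν + j * Real.pi + (Real.pi / 2 - ε) := by
    unfold besselShift
    have : Real.pi * N + Real.pi * m = Real.pi * j + Real.pi := by rw [← mul_add, hj']; ring
    linarith [h1.1, h1.2]
  have h4 := besselCount_mono hν h3
  omega

theorem besselDerivCount_mono {ν : ℝ} (hν : 0 ≤ ν) : Monotone (besselDerivCount ν) :=
  fun _ y h => ncard_le_ncard (inter_subset_inter_right _ (Iic_subset_Iic.2 h))
    (finite_besselDerivZeros hν y)

theorem tendsto_besselK_div {ν : ℝ} (hν : 0 ≤ ν) : ∃ A > 0,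
    Tendsto (fun x => -besselK ν x / Real.sqrt x -
      A * Real.cos (x - besselShift (ν + 1))) atTop (𝓝 0) := by
  obtain ⟨A₀, -, h0⟩ := hasBesselAsymptotics hν
  obtain ⟨A, hA, h1⟩ := hasBesselAsymptotics (ν := ν + 1) (by positivity)
  refine ⟨A, hA, ?_⟩
  have hx : Tendsto (fun x : ℝ => ν / x) atTop (𝓝 0) := tendsto_id.const_div_atTop _
  have h4 : Tendsto (fun x => ν / x *
      (A₀ * Real.cos (x - (ν * Real.pi / 2 + Real.pi / 4)))) atTop (𝓝 0) := by
    have h7 : Tendsto (fun x : ℝ => ‖ν / x‖ * ‖A₀‖) atTop (𝓝 0) := by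
      simpa using hx.norm.mul_const ‖A₀‖
    refine squeeze_zero_norm (fun x => ?_) h7
    rw [norm_mul, norm_mul]
    refine mul_le_mul_of_nonneg_left ?_ (norm_nonneg _)
    exact mul_le_of_le_one_right (norm_nonneg _) (Real.abs_cos_le_one _)
  have h6 := h1.sub ((hx.mul h0).add h4)
  rw [mul_zero, add_zero, sub_zero] at h6
  refine h6.congr' ?_
  filter_upwards [eventually_gt_atTop 0] with x hx0
  have hs := Real.sqrt_pos.2 hx0
  have hs2 := Real.sq_sqrt hx0.le
  rw [besselK, besselShift]
  generalize Real.sqrt x = r at *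
  rw [← hs2]
  field_simp
  ring

/-- The asymptotics of J_{ν+1} make xJ_ν' change sign near α + kπ. At the resulting zero J_ν already
has k zeros behind it, and Rolle's count gives one more for J_ν'. -/
theorem eventually_lt_besselDerivCount {ν ε : ℝ} (hν : 0 ≤ ν) (hε : 0 < ε)
    (hε4 : ε ≤ Real.pi / 4) :
    ∀ᶠ k : ℕ in atTop, k < besselDerivCount ν (besselShift ν + k * Real.pi + ε) := by
  have hpi := Real.pi_pos
  obtain ⟨A, hA, h⟩ := tendsto_besselK_div hν
  have hsign := eventually_sign_of_tendsto_cos hA hε h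
  rw [← map_add_atTop_eq_nat 1, eventually_map]
  filter_upwards [hsign, (tendsto_add_atTop_nat 1).eventually hsign,
    (tendsto_add_atTop_nat 1).eventually (besselCountAsymptotics hν (Real.pi / 4) (by positivity))]
    with k h1 h2 h3
  have hα : 0 < besselShift ν := by unfold besselShift; positivity
  have hkp : 0 ≤ (k : ℝ) * Real.pi := by positivity
  set x₁ := besselShift ν + (k + 1 : ℕ) * Real.pi - ε with hx₁
  set x₂ := besselShift ν + (k + 1 : ℕ) * Real.pi + ε with hx₂
  have hx₁0 : 0 < x₁ := by rw [hx₁]; push_cast; linarith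
  have g1 := h1 x₁ (by
    rw [besselShift_succ, hx₁, show besselShift ν + (k + 1 : ℕ) * Real.pi - ε -
      (besselShift ν + Real.pi / 2) - k * Real.pi = Real.pi / 2 - ε by push_cast; ring,
      abs_of_nonneg (by linarith)])
  have g2 := h2 x₂ (by
    rw [besselShift_succ, hx₂, show besselShift ν + (k + 1 : ℕ) * Real.pi + ε -
      (besselShift ν + Real.pi / 2) - (k + 1 : ℕ) * Real.pi = -(Real.pi / 2 - ε) by ring,
      abs_neg, abs_of_nonneg (by linarith)])
  have g1' : 0 < -((-1) ^ k * besselK ν x₁) := by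
    have := mul_pos g1 (Real.sqrt_pos.2 hx₁0)
    have hs := (Real.sqrt_pos.2 hx₁0).ne'
    field_simp at this
    linarith
  have hx₂0 : 0 < x₂ := by linarith
  have g2' : 0 < (-1) ^ k * besselK ν x₂ := by
    have := mul_pos g2 (Real.sqrt_pos.2 hx₂0)
    have hs := (Real.sqrt_pos.2 hx₂0).ne'
    rw [pow_succ] at this
    field_simp at this
    linarith
  obtain ⟨c, hc, hc0⟩ := intermediate_value_Icc (f := fun x => (-1) ^ k * besselK ν x)
    (show x₁ ≤ x₂ by linarith)
    (continuousOn_const.mul ((continuousOn_besselK hν).mono fun z hz => hx₁0.trans_le hz.1))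
    (⟨by linarith, by linarith⟩ : (0 : ℝ) ∈ Icc _ _)
  have hKc : besselK ν c = 0 := (mul_eq_zero.1 hc0).resolve_left (by positivity)
  have h4 := besselCount_lt_besselDerivCount hν (hx₁0.trans_le hc.1) hKc
  have h5 := h3 c (by rw [abs_le]; constructor <;> linarith [hc.1, hc.2])
  have h6 := besselDerivCount_mono hν hc.2
  omega

theorem le_besselDerivCount_of_lt {ν x : ℝ} {k : ℕ} (hν : 0 ≤ ν) (hx : ν < x)
    (hk : Real.pi * k < besselPhase ν x + 3 * Real.pi / 4) : k ≤ besselDerivCount ν x := by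
  by_contra! hlt
  set N := besselDerivCount ν x
  set δ := besselPhase ν x + 3 * Real.pi / 4 - Real.pi * k with hδ
  have hδ0 : 0 < δ := by linarith
  have hpi := Real.pi_pos
  have hmin : min (δ / 2) (Real.pi / 4) ≤ δ / 2 := min_le_left _ _
  set ε := min (δ / 2) (Real.pi / 4) with hε
  have hε0 : 0 < ε := lt_min (by linarith) (by linarith)
  obtain ⟨K, hK⟩ := eventually_atTop.1 (eventually_lt_besselDerivCount hν hε0 (min_le_right _ _))
  obtain ⟨m, hm, hmK⟩ := ((eventually_abs_besselPhase_sub_lt (s := besselPhase ν x) hν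
    (half_pos hδ0)).and (eventually_ge_atTop (K + 1))).exists
  obtain ⟨b, hxb, hs, hN⟩ := exists_besselDerivCount_le_add hν hx m
  have h1 := abs_lt.1 (hm b (by linarith) hs)
  -- The margin δ puts b at or beyond α + jπ + ε, where J_ν' has more than j = k + m - 1 zeros,
  -- against at most N + m < k + m.
  obtain ⟨j, hj⟩ : ∃ j, k + m = j + 1 := ⟨k + m - 1, by omega⟩
  have hj' : (k : ℝ) + m = j + 1 := by exact_mod_cast hj
  have h2 := hK j (by omega)
  have h3 : besselShift ν + j * Real.pi + ε ≤ b := by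
    unfold besselShift
    have : Real.pi * k + Real.pi * m = Real.pi * j + Real.pi := by rw [← mul_add, hj']; ring
    linarith [h1.1, h1.2]
  have h4 := besselDerivCount_mono hν h3
  omega

/-- Equality reduces to the strict case: the count is unchanged slightly to the right of x, while
the phase strictly grows. -/
theorem le_besselDerivCount {ν x : ℝ} {k : ℕ} (hν : 0 ≤ ν) (hx : ν < x)
    (hk : Real.pi * k ≤ besselPhase ν x + 3 * Real.pi / 4) : k ≤ besselDerivCount ν x := by
  obtain ⟨y, hxy, hy⟩ : ∃ y, x < y ∧ besselDerivCount ν y = besselDerivCount ν x := by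
    have hfin : (besselDerivZeros ν ∩ Ioc x (x + 1)).Finite :=
      (finite_besselDerivZeros hν (x + 1)).subset fun z hz => ⟨hz.1, hz.2.2⟩
    have key : ∀ y, x < y → (∀ z ∈ Ioc x y, z ∉ besselDerivZeros ν) →
        besselDerivCount ν y = besselDerivCount ν x := fun y hxy h => by
      unfold besselDerivCount
      congr 1
      ext z
      refine ⟨fun hz => ⟨hz.1, ?_⟩, fun hz => ⟨hz.1, hz.2.trans hxy.le⟩⟩
      by_contra hzx
      exact h z ⟨not_le.1 hzx, hz.2⟩ hz.1
    rcases (besselDerivZeros ν ∩ Ioc x (x + 1)).eq_empty_or_nonempty with he | hne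
    · refine ⟨x + 1, by linarith, key _ (by linarith) fun z hz hz0 => ?_⟩
      exact (he ▸ (⟨hz0, hz⟩ : z ∈ besselDerivZeros ν ∩ Ioc x (x + 1)) : z ∈ (∅ : Set ℝ))
    · obtain ⟨d, ⟨hd, hxd, hd1⟩, hmin⟩ := hfin.exists_minimal hne
      refine ⟨(x + d) / 2, by linarith, key _ (by linarith) fun z hz hz0 => ?_⟩
      have hzd : z < d := by linarith [hz.2]
      exact not_lt.2 (hmin ⟨hz0, hz.1, hzd.le.trans hd1⟩ hzd.le) hzd
  rw [← hy]
  refine le_besselDerivCount_of_lt hν (hx.trans hxy) (hk.trans_lt ?_)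
  have := strictMonoOn_besselPhase hν hx (hx.trans hxy) hxy
  linarith

/-! ### Enumerating a discrete set in increasing order -/

/-- The position of `x` in a set `S` of reals, counted from `1`. -/
noncomputable def rankIn (S : Set ℝ) (x : ℝ) : ℕ := (S ∩ Iio x).ncard + 1

theorem finite_inter_Iio {S : Set ℝ} (hS : ∀ X, (S ∩ Iic X).Finite) (x : ℝ) :
    (S ∩ Iio x).Finite :=
  (hS x).subset (inter_subset_inter_right _ Iio_subset_Iic_self)

theorem rankIn_strictMonoOn {S : Set ℝ} (hS : ∀ X, (S ∩ Iic X).Finite) :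
    StrictMonoOn (rankIn S) S := fun x hx y _ hxy =>
  Nat.add_lt_add_right (ncard_lt_ncard ⟨inter_subset_inter_right _ (Iio_subset_Iio hxy.le),
    fun h => lt_irrefl x (h ⟨hx, hxy⟩).2⟩ (finite_inter_Iio hS y)) 1

theorem kthElement_rankIn {S : Set ℝ} (hS : ∀ X, (S ∩ Iic X).Finite) {x : ℝ} (hx : x ∈ S) :
    kthElement S (rankIn S x) = x := by
  have h : {y : ℝ | y ∈ S ∧ (S ∩ Iio y).encard + 1 = (rankIn S x : ℕ∞)} = {x} := by
    ext y
    have hy : (S ∩ Iio y).encard + 1 = (rankIn S y : ℕ∞) := by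
      rw [rankIn, Nat.cast_add, (finite_inter_Iio hS y).cast_ncard_eq, Nat.cast_one]
    rw [mem_ofPred_eq, hy, mem_singleton_iff, Nat.cast_inj]
    exact ⟨fun ⟨h1, h2⟩ => (rankIn_strictMonoOn hS).injOn h1 hx h2, by rintro rfl; exact ⟨hx, rfl⟩⟩
  rw [kthElement, h, csInf_singleton]

theorem exists_rankIn_eq {S : Set ℝ} (hS : ∀ X, (S ∩ Iic X).Finite) (hinf : S.Infinite) (k : ℕ) :
    ∃ x ∈ S, rankIn S x = k + 1 := by
  induction k with
  | zero =>
    obtain ⟨y, hy⟩ := hinf.nonempty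
    obtain ⟨x, ⟨hx, hxy⟩, hmin⟩ := (hS y).exists_minimal ⟨y, hy, le_refl y⟩
    refine ⟨x, hx, ?_⟩
    have : S ∩ Iio x = ∅ := eq_empty_of_forall_notMem fun z hz =>
      have hzx : z < x := hz.2
      not_lt.2 (hmin ⟨hz.1, hzx.le.trans hxy⟩ hzx.le) hzx
    rw [rankIn, this, ncard_empty]
  | succ k ih =>
    obtain ⟨x, hx, hk⟩ := ih
    obtain ⟨y, hy, hxy⟩ : ∃ y ∈ S, x < y := by
      by_contra! h
      exact hinf ((hS x).subset fun y hy => ⟨hy, h y hy⟩)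
    obtain ⟨d, ⟨hd, hxd, hdy⟩, hmin⟩ := ((hS y).subset fun z (hz : z ∈ S ∩ Ioc x y) =>
      ⟨hz.1, hz.2.2⟩).exists_minimal ⟨y, hy, hxy, le_refl y⟩
    refine ⟨d, hd, ?_⟩
    have : S ∩ Iio d = insert x (S ∩ Iio x) := by
      ext z
      simp only [mem_inter_iff, mem_Iio, mem_insert_iff]
      constructor
      · rintro ⟨hz, hzd⟩
        rcases lt_trichotomy z x with h | h | h
        · exact Or.inr ⟨hz, h⟩
        · exact Or.inl h
        · exact absurd (hmin ⟨hz, h, hzd.le.trans hdy⟩ hzd.le) (not_le.2 hzd)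
      · rintro (rfl | ⟨hz, hzx⟩)
        · exact ⟨hx, hxd⟩
        · exact ⟨hz, hzx.trans hxd⟩
    rw [rankIn, this, ncard_insert_of_notMem (fun h => lt_irrefl x h.2) (finite_inter_Iio hS x)]
    rw [rankIn] at hk
    omega

/-- Infinitude of S matters: past the last element of a finite set, `kthElement` takes the default
value 0, and for X ≥ 0 all those k would be included. -/
theorem setOf_kthElement_le {S : Set ℝ} (hS : ∀ X, (S ∩ Iic X).Finite) (hinf : S.Infinite)
    (X : ℝ) : {k : ℕ | 1 ≤ k ∧ kthElement S k ≤ X} = rankIn S '' (S ∩ Iic X) := by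
  ext k
  constructor
  · rintro ⟨hk, hX⟩
    obtain ⟨x, hx, hr⟩ := exists_rankIn_eq hS hinf (k - 1)
    have hr' : rankIn S x = k := by omega
    rw [← hr', kthElement_rankIn hS hx] at hX
    exact ⟨x, ⟨hx, hX⟩, hr'⟩
  · rintro ⟨x, ⟨hx, hX⟩, rfl⟩
    exact ⟨Nat.le_add_left 1 _, (kthElement_rankIn hS hx).trans_le hX⟩

theorem finite_setOf_kthElement_le {S : Set ℝ} (hS : ∀ X, (S ∩ Iic X).Finite)
    (hinf : S.Infinite) (X : ℝ) : {k : ℕ | 1 ≤ k ∧ kthElement S k ≤ X}.Finite := by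
  rw [setOf_kthElement_le hS hinf]
  exact (hS X).image _

theorem ncard_setOf_kthElement_le {S : Set ℝ} (hS : ∀ X, (S ∩ Iic X).Finite)
    (hinf : S.Infinite) (X : ℝ) :
    {k : ℕ | 1 ≤ k ∧ kthElement S k ≤ X}.ncard = (S ∩ Iic X).ncard := by
  rw [setOf_kthElement_le hS hinf]
  exact ((rankIn_strictMonoOn hS).injOn.mono inter_subset_left).ncard_image

theorem infinite_besselZeros {ν : ℝ} (hν : 0 ≤ ν) : (besselZeros ν).Infinite := by
  intro hfin
  obtain ⟨k, hk, hlt⟩ := (((besselCountAsymptotics hν).eventually_eq abs_pi_div_four_lt).and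
    (eventually_gt_atTop (besselZeros ν).ncard)).exists
  have : besselCount ν (besselShift ν + k * Real.pi + Real.pi / 4) ≤ (besselZeros ν).ncard :=
    ncard_le_ncard inter_subset_left hfin
  omega

theorem infinite_besselDerivZeros {ν : ℝ} (hν : 0 ≤ ν) : (besselDerivZeros ν).Infinite := by
  intro hfin
  obtain ⟨k, hk, hlt⟩ := ((eventually_lt_besselDerivCount hν
    (show 0 < Real.pi / 4 by positivity) le_rfl).and
    (eventually_gt_atTop (besselDerivZeros ν).ncard)).exists
  have : besselDerivCount ν (besselShift ν + k * Real.pi + Real.pi / 4) ≤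
    (besselDerivZeros ν).ncard := ncard_le_ncard inter_subset_left hfin
  omega

/-! ### From the phase bounds to integer parts -/

theorem funG_eq (lam ν : ℝ) : funG lam ν = besselPhase ν lam / Real.pi := by
  rw [funG, besselPhase]; ring

theorem besselCount_eq_zero {ν x : ℝ} (hν : 0 ≤ ν) (hx : x ≤ ν) : besselCount ν x = 0 := by
  have : besselZeros ν ∩ Iic x = ∅ := eq_empty_of_forall_notMem fun z hz =>
    besselJ_ne_zero_of_le hν hz.1.1 (hz.2.trans hx) hz.1.2
  rw [besselCount, this, ncard_empty]

/-- At lam = ν both branches agree, because G vanishes there. -/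
theorem funA_of_le {s ν lam : ℝ} (h : lam ≤ ν) : funA s ν lam = s := by
  rcases h.eq_or_lt with rfl | h
  · rw [funA, if_pos le_rfl, funG]
    rcases eq_or_ne lam 0 with rfl | h0
    · simp
    · simp [h0]
  · rw [funA, if_neg (not_le.2 h)]

theorem besselCount_le_floor_funAD {ν lam : ℝ} (hν : 0 ≤ ν) :
    (besselCount ν lam : ℤ) ≤ ⌊funAD ν lam⌋ := by
  rw [Int.le_floor, funAD]
  rcases le_or_gt lam ν with h | h
  · rw [besselCount_eq_zero hν h, funA_of_le h]; norm_num
  · rw [funA, if_pos h.le, funG_eq]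
    have h1 := pi_mul_besselCount_le hν h
    have hpi := Real.pi_pos
    rw [div_add' _ _ _ hpi.ne', le_div_iff₀ hpi]
    push_cast
    linarith

theorem floor_funAN_le_besselDerivCount {ν lam : ℝ} (hν : 0 ≤ ν) :
    ⌊funAN ν lam⌋ ≤ (besselDerivCount ν lam : ℤ) := by
  rcases le_or_gt lam ν with h | h
  · rw [funAN, funA_of_le h]
    norm_num
  · rcases le_or_gt ⌊funAN ν lam⌋ 0 with h0 | h0
    · omega
    obtain ⟨k, hk⟩ := Int.eq_ofNat_of_zero_le h0.le
    rw [hk]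
    have h1 : (k : ℝ) ≤ funAN ν lam := by
      have := Int.floor_le (funAN ν lam)
      rw [hk] at this
      exact_mod_cast this
    rw [funAN, funA, if_pos h.le, funG_eq] at h1
    have hpi := Real.pi_pos
    rw [div_add' _ _ _ hpi.ne', le_div_iff₀ hpi] at h1
    have := le_besselDerivCount (k := k) hν h (by linarith)
    exact_mod_cast this

theorem proposition3p1 (ν lam : ℝ) (hν : 0 ≤ ν) (hlam : 0 ≤ lam) :
    ({k : ℕ | 1 ≤ k ∧ besselJZero ν k ≤ lam}.Finite ∧
      (({k : ℕ | 1 ≤ k ∧ besselJZero ν k ≤ lam}.ncard : ℤ) ≤ ⌊funAD ν lam⌋)) ∧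
    ({k : ℕ | 1 ≤ k ∧ besselJDerivZero ν k ≤ lam}.Finite ∧
      (⌊funAN ν lam⌋ ≤ ({k : ℕ | 1 ≤ k ∧ besselJDerivZero ν k ≤ lam}.ncard : ℤ))) := by
  have hS := finite_besselZeros hν
  have hT := finite_besselDerivZeros hν
  have hSi := infinite_besselZeros hν
  have hTi := infinite_besselDerivZeros hν
  refine ⟨⟨finite_setOf_kthElement_le hS hSi lam, ?_⟩,
    finite_setOf_kthElement_le hT hTi lam, ?_⟩
  · exact (congrArg Nat.cast (ncard_setOf_kthElement_le hS hSi lam)).trans_le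
      (besselCount_le_floor_funAD hν)
  · exact (floor_funAN_le_besselDerivCount hν).trans_eq
      (congrArg Nat.cast (ncard_setOf_kthElement_le hT hTi lam).symm)
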